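/- Let $R$ be a commutative ring. For a (discrete) group $G$ let $\Delta_G=\coprod_{H} G/H$, where $H$ runs over the finite subgroups of $G$. An $RG$-module is called $\mathfrak F$-projective if it is a direct summand of $M\otimes_R R\Delta_G$ (with diagonal $G$-action) for some $RG$-module $M$. A resolution $\cdots\to P_1\to P_0\to R\to 0$ of the trivial $RG$-module $R$ is called $\mathfrak F$-split if it is exact and the short exact sequences into which it breaks up split over $RH$ for every finite subgroup $H\le G$. The $\mathfrak F$-cohomological dimension $\mathfrak F\mathrm{cd}\,G\in\{0,1,2,\dots\}\cup\{\infty\}$ of $G$ over $R$ is the shortest length of an $\mathfrak F$-split resolution of $R$ by $\mathfrak F$-projective $RG$-modules ($\infty$ if there is none of finite length). Let $1\to N\to G\to Q\to 1$ be a short exact sequence of groups. If $\mathfrak F\mathrm{cd}\,G<\infty$, then \[ \mathfrak F\mathrm{cd}\,G\le \mathfrak F\mathrm{cd}\,N+\mathfrak F\mathrm{cd}\,Q . \] -/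

import Mathlib

universe u v w

namespace FCohomology

/-- The `G`-set `Δ = ∐ G/H`, where `H` runs over the finite subgroups of `G`. -/
abbrev Delta (G : Type v) [Group G] : Type v :=
  Σ H : {H : Subgroup G // Finite H}, G ⧸ H.1

section

variable (R : Type u) [CommRing R] (G : Type v) [Group G]

/-- The permutation module `RΔ`. -/
noncomputable abbrev permDelta : Representation R G (MonoidAlgebra R (Delta G)) :=
  Representation.ofMulAction R G (Delta G)

variable {R G}

/-- An `RG`-module is `𝔉`-projective if it is a direct summand of `M ⊗_R RΔ`, with the diagonal
action of `G`, for some `RG`-module `M`. -/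
def IsFProjective (P : Rep.{max u v} R G) : Prop :=
  ∃ M : Rep.{max u v} R G,
    Nonempty (CategoryTheory.Retract P (Rep.of (M.ρ.tprod (permDelta R G))))

/-- A homomorphism `f` of `RG`-modules is `𝔉`-split if for every finite subgroup `H` of `G` there
is an `RH`-linear map `s` in the opposite direction with `f s f = f`. For surjective `f` this says
that `f` has an `RH`-linear section; an exact complex all of whose differentials are `𝔉`-split is
one that breaks up into short exact sequences which split over every finite subgroup. -/
def IsFSplit {V W : Type*} [AddCommGroup V] [Module R V] [AddCommGroup W] [Module R W]
    {ρ : Representation R G V} {σ : Representation R G W} (f : ρ.IntertwiningMap σ) : Prop :=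
  ∀ H : Subgroup G, Finite H →
    ∃ s : Representation.IntertwiningMap (σ.comp H.subtype) (ρ.comp H.subtype),
      ∀ x : V, f (s (f x)) = f x

/-- An `𝔉`-split resolution `⋯ → P₂ → P₁ → P₀ → V → 0` of an `RG`-module `V` by `𝔉`-projective
modules. -/
structure FResolution {V : Type w} [AddCommGroup V] [Module R V] (ρ : Representation R G V) where
  /-- the modules of the resolution -/
  P : ℕ → Rep.{max u v} R G
  /-- the differentials -/
  d : ∀ i : ℕ, (P (i + 1)).ρ.IntertwiningMap (P i).ρ
  /-- the augmentation -/
  ε : (P 0).ρ.IntertwiningMap ρ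
  fProjective : ∀ i, IsFProjective (P i)
  surjective_ε : Function.Surjective ε
  exact_zero : Function.Exact (d 0) ε
  exact_succ : ∀ i, Function.Exact (d (i + 1)) (d i)
  fSplit_ε : IsFSplit ε
  fSplit_d : ∀ i, IsFSplit (d i)

/-- The resolution has length at most `n`: the modules in degrees above `n` vanish. -/
def FResolution.LengthLE {V : Type w} [AddCommGroup V] [Module R V] {ρ : Representation R G V}
    (X : FResolution ρ) (n : ℕ) : Prop :=
  ∀ i, n < i → Subsingleton (X.P i).V

variable (R G)

/-- The `𝔉`-cohomological dimension of `G` over `R`: the shortest length of an `𝔉`-split resolution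
of the trivial module `R` by `𝔉`-projectives, and `⊤` if there is none of finite length. -/
noncomputable def Fcd : ℕ∞ :=
  sInf {m : ℕ∞ | ∃ n : ℕ, m = n ∧
    ∃ X : FResolution (Representation.trivial R G R), X.LengthLE n}

end

end FCohomology

/-! Let `Y` be a `G`-set with finite stabilisers in which every finite subgroup has a fixed point.
An `𝔉`-split `𝔉`-projective resolution of length `n` exists exactly when the equivariant cochains on
tuples from `Y` have no cohomology above degree `n`, for all coefficients (`HasFResolution.acyclic`,
`Acyclic.hasFResolution`). The criterion does not depend on `Y` and passes to subgroups.

A resolution `P` of length `q` over `Q` gives a double complex with columns of cochains in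
`Hom_R(P_i, A)`. By Shapiro's lemma the columns only see preimages `L` of finite subgroups of `Q`,
so vanishing above `n` for every `L` gives vanishing above `n + q` for `G`
(`acyclic_of_fResolution`).

Such an `L` contains `N` with finite index and has finite dimension, being a subgroup of `G`. It
remains to see that a finite extension of finite dimension needs no longer resolution than `N`
(`hasFResolution_of_finiteIndex`). Write `G` for this extension and take for `Y` the functions `G ⧸
N → X`, whose chains are tensor induced from those of `X`. A cocycle extends to a multilinear map,
which on equivariant families is additive up to transfers from stabilisers of proper nonempty
subsets of `G ⧸ N`. Applying the conjugates of an `N`-contraction factor by factor shows that a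
cocycle of degree `m > n` is cohomologous to a sum of transfers. If cohomology vanishes above `m`,
the summands can be made cocycles, and these die by induction on the index. Descending induction on
`m` starts from the finite dimension. -/

namespace FCohomology

/-! ### Homogeneous cochains -/

section Cochain

variable {Y A B : Type*} [AddCommGroup A] [AddCommGroup B]

/-- The homogeneous coboundary; a cochain on `n` points is a function `(Fin n → Y) → A`. -/
def cobd {n : ℕ} : ((Fin n → Y) → A) →+ ((Fin (n + 1) → Y) → A) where
  toFun f y := ∑ j : Fin (n + 1), (-1 : ℤ) ^ (j : ℕ) • f (j.removeNth y)
  map_zero' := by ext; simp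
  map_add' f g := by ext; simp [Finset.sum_add_distrib]

lemma cobd_apply {n : ℕ} (f : (Fin n → Y) → A) (y : Fin (n + 1) → Y) :
    cobd f y = ∑ j : Fin (n + 1), (-1 : ℤ) ^ (j : ℕ) • f (j.removeNth y) := rfl

lemma map_cobd (φ : A →+ B) {n : ℕ} (f : (Fin n → Y) → A) (y : Fin (n + 1) → Y) :
    φ (cobd f y) = cobd (fun z => φ (f z)) y := by
  simp [cobd_apply, map_sum, map_zsmul]

lemma cobd_zero_points (f : (Fin 0 → Y) → A) (y : Fin 1 → Y) (z : Fin 0 → Y) :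
    cobd f y = f z := by
  simp [cobd_apply, Subsingleton.elim _ z]

/-- Deleting the apex gives `f y`; the other faces keep it, with sign shifted by one. This cone
formula is the source of `cobd_cobd` and of all contractions. -/
lemma cobd_cons {n : ℕ} (f : (Fin (n + 1) → Y) → A) (x : Y) (y : Fin (n + 1) → Y) :
    cobd f (Fin.cons x y) = f y - cobd (fun z => f (Fin.cons x z)) y := by
  rw [cobd_apply, Fin.sum_univ_succ, cobd_apply, sub_eq_add_neg, ← Finset.sum_neg_distrib]
  congr 1
  · simp
  · refine Finset.sum_congr rfl fun j _ => ?_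
    have : (j.succ).removeNth (Fin.cons x y : Fin (n + 2) → Y)
        = (Fin.cons x (j.removeNth y) : Fin (n + 1) → Y) := by
      ext i
      refine Fin.cases ?_ (fun i => ?_) i <;> simp [Fin.removeNth]
    rw [this, Fin.val_succ, pow_succ]
    simp

lemma cobd_cobd {n : ℕ} (f : (Fin n → Y) → A) : cobd (cobd f) = 0 := by
  induction n with
  | zero =>
    ext y
    rw [← Fin.cons_self_tail y, cobd_cons, Pi.zero_apply,
      cobd_zero_points f _ Fin.elim0, sub_eq_zero]
    have : (fun z => cobd f (Fin.cons (y 0) z : Fin 1 → Y)) = f := by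
      ext z; exact cobd_zero_points f _ z
    rw [this, cobd_zero_points f _ Fin.elim0]
  | succ n ih =>
    ext y
    rw [← Fin.cons_self_tail y, cobd_cons]
    have : (fun z => cobd f (Fin.cons (y 0) z : Fin (n + 2) → Y))
        = f - cobd (fun z => f (Fin.cons (y 0) z)) := by
      ext z; rw [cobd_cons]; rfl
    rw [this, map_sub, ih]
    simp

end Cochain

/-! ### Equivariant maps and choices along orbits -/

section Equivariant

variable {R : Type u} [CommRing R] {G : Type*} [Group G]

/-- A map from a `G`-set to a representation is equivariant. -/
def IsEquivariant {Z A : Type*} [AddCommGroup A] [Module R A] (z : G →* Equiv.Perm Z)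
    (ρ : Representation R G A) (f : Z → A) : Prop :=
  ∀ g x, f (z g x) = ρ g (f x)

/-- The diagonal action on tuples. -/
def powAct {Y : Type*} (a : G →* Equiv.Perm Y) (n : ℕ) : G →* Equiv.Perm (Fin n → Y) where
  toFun g :=
    { toFun := fun y i => a g (y i)
      invFun := fun y i => a g⁻¹ (y i)
      left_inv := fun y => by ext i; simp
      right_inv := fun y => by ext i; simp }
  map_one' := by ext; simp
  map_mul' g h := by ext; simp

@[simp] lemma powAct_apply {Y : Type*} (a : G →* Equiv.Perm Y) (n : ℕ) (g : G) (y : Fin n → Y)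
    (i : Fin n) : powAct a n g y i = a g (y i) := rfl

lemma powAct_cons {Y : Type*} (a : G →* Equiv.Perm Y) (n : ℕ) (g : G) (x : Y) (y : Fin n → Y) :
    powAct a (n + 1) g (Fin.cons x y) = Fin.cons (a g x) (powAct a n g y) := by
  ext i; refine Fin.cases ?_ (fun i => ?_) i <;> simp

lemma powAct_removeNth {Y : Type*} (a : G →* Equiv.Perm Y) (n : ℕ) (g : G) (y : Fin (n + 1) → Y)
    (j : Fin (n + 1)) : j.removeNth (powAct a (n + 1) g y) = powAct a n g (j.removeNth y) := rfl

variable {Y A : Type*} [AddCommGroup A] [Module R A] {a : G →* Equiv.Perm Y}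
  {ρ : Representation R G A}

lemma IsEquivariant.cobd {n : ℕ} {f : (Fin n → Y) → A} (hf : IsEquivariant (powAct a n) ρ f) :
    IsEquivariant (powAct a (n + 1)) ρ (cobd f) := by
  intro g y
  simp only [cobd_apply, map_sum, map_zsmul, powAct_removeNth, hf g]

section

variable {Z : Type*} {z : G →* Equiv.Perm Z}

lemma IsEquivariant.add {f g : Z → A} (hf : IsEquivariant z ρ f) (hg : IsEquivariant z ρ g) :
    IsEquivariant z ρ (f + g) := fun γ x => by simp [hf γ x, hg γ x]

lemma IsEquivariant.sub {f g : Z → A} (hf : IsEquivariant z ρ f) (hg : IsEquivariant z ρ g) :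
    IsEquivariant z ρ (f - g) := fun γ x => by simp [hf γ x, hg γ x]

end

/-- Choosing an equivariant section of an invariant relation. -/
lemma exists_equivariant_section {Z T : Type*} (z : G →* Equiv.Perm Z) (t : G →* Equiv.Perm T)
    (P : Z → T → Prop) (hP : ∀ g x s, P x s → P (z g x) (t g s))
    (h : ∀ x, ∃ s, P x s ∧ ∀ g, z g x = x → t g s = s) :
    ∃ s : Z → T, (∀ g x, s (z g x) = t g (s x)) ∧ ∀ x, P x (s x) := by
  classical
  let r : Setoid Z :=
    { r := fun x y => ∃ g, z g x = y
      iseqv := ⟨fun x => ⟨1, by simp⟩, fun {x y} ⟨g, hg⟩ => ⟨g⁻¹, by simp [← hg]⟩,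
        fun {x y w} ⟨g, hg⟩ ⟨k, hk⟩ => ⟨k * g, by simp [hg, hk]⟩⟩ }
  choose s hs hfix using h
  have hrep : ∀ x, ∃ g, z g (Quotient.out (s := r) ⟦x⟧) = x := fun x =>
    Quotient.mk_out (s := r) x
  choose c hc using hrep
  -- Two elements carrying `x` to `y` differ by a stabiliser element, which fixes `s x`; so
  -- translating from an orbit representative is independent of the choice `c`.
  have key : ∀ x y g k, z g x = y → z k x = y → t g (s x) = t k (s x) := by
    intro x y g k hg hk
    have : t (k⁻¹ * g) (s x) = s x := hfix x _ (by simp [hg, ← hk])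
    have h2 := congrArg (t k) this
    simpa using h2
  refine ⟨fun x => t (c x) (s (Quotient.out (s := r) ⟦x⟧)), fun g x => ?_, fun x => ?_⟩
  · have : (⟦z g x⟧ : Quotient r) = ⟦x⟧ := Quotient.sound (r.symm ⟨g, rfl⟩)
    have hcx := hc (z g x)
    rw [this] at hcx
    simp only [this]
    rw [← Equiv.Perm.mul_apply, ← map_mul]
    exact key _ (z g x) _ _ hcx (by simp [hc x])
  · have := hP (c x) _ _ (hs (Quotient.out (s := r) ⟦x⟧))
    rwa [hc x] at this

end Equivariant

/-! ### Acyclicity and Shapiro's lemma -/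

section Acyclic

variable (R : Type u) [CommRing R]

/-- The equivariant cochains on the `G`-set `Y` have no cohomology above degree `n`, whatever
the coefficients. -/
def Acyclic {G : Type*} [Group G] {Y : Type v} (a : G →* Equiv.Perm Y) (n : ℕ) : Prop :=
  ∀ (A : Type max u v) [AddCommGroup A] [Module R A] (ρ : Representation R G A) (b : ℕ), n < b →
    ∀ f : (Fin (b + 1) → Y) → A, IsEquivariant (powAct a (b + 1)) ρ f → cobd f = 0 →
      ∃ g : (Fin b → Y) → A, IsEquivariant (powAct a b) ρ g ∧ cobd g = f

/-- Stabilisers are finite and every finite subgroup has a fixed point. -/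
structure IsProperUniversal {G Y : Type*} [Group G] (a : G →* Equiv.Perm Y) : Prop where
  finite_stab : ∀ y, {g | a g y = y}.Finite
  exists_fixed : ∀ H : Subgroup G, Finite H → ∃ y, ∀ h ∈ H, a h y = y

variable {R}
variable {G : Type*} [Group G]

lemma finite_stab_powAct {Y : Type*} {a : G →* Equiv.Perm Y} (h : ∀ y, {g | a g y = y}.Finite)
    {n : ℕ} (y : Fin (n + 1) → Y) : {g | powAct a (n + 1) g y = y}.Finite :=
  (h (y 0)).subset fun _ hg => congrFun hg 0

lemma IsProperUniversal.comp {K Y : Type*} [Group K] {a : G →* Equiv.Perm Y}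
    (h : IsProperUniversal a) {j : K →* G} (hj : Function.Injective j) :
    IsProperUniversal (a.comp j) where
  finite_stab y := (h.finite_stab y).preimage hj.injOn
  exists_fixed H hH := by
    obtain ⟨y, hy⟩ := h.exists_fixed (H.map j) (Set.Finite.image j (Set.toFinite (H : Set K)))
    exact ⟨y, fun k hk => hy _ (Subgroup.mem_map_of_mem j hk)⟩

/-- A fixed point contracts the cochain complex. -/
lemma acyclic_of_fixed {Y : Type v} {a : G →* Equiv.Perm Y} {y₀ : Y} (h : ∀ g, a g y₀ = y₀)
    (n : ℕ) : Acyclic R a n := by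
  intro A _ _ ρ b hb f hf hd
  refine ⟨fun y => f (Fin.cons y₀ y), fun g y => ?_, ?_⟩
  · rw [← hf g, powAct_cons, h]
  · obtain ⟨b, rfl⟩ : ∃ c, b = c + 1 := ⟨b - 1, by omega⟩
    ext y
    have := cobd_cons f y₀ y
    rw [hd, Pi.zero_apply, eq_comm, sub_eq_zero] at this
    exact this.symm

/-- The action on functions from a `G`-set to a representation. -/
def funAct {Z A : Type*} [AddCommGroup A] [Module R A] (z : G →* Equiv.Perm Z)
    (ρ : Representation R G A) : G →* Equiv.Perm (Z → A) where
  toFun g :=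
    { toFun := fun f x => ρ g (f (z g⁻¹ x))
      invFun := fun f x => ρ g⁻¹ (f (z g x))
      left_inv := fun f => by ext x; simp
      right_inv := fun f => by ext x; simp }
  map_one' := by ext; simp
  map_mul' g h := by ext; simp

lemma funAct_apply {Z A : Type*} [AddCommGroup A] [Module R A] (z : G →* Equiv.Perm Z)
    (ρ : Representation R G A) (g : G) (f : Z → A) (x : Z) :
    funAct z ρ g f x = ρ g (f (z g⁻¹ x)) := rfl

/-- Shapiro's lemma for families of cochains indexed by a `G`-set `S`. -/
lemma exists_cobd_eq_of_stabilizers {Y : Type v} {a : G →* Equiv.Perm Y} {S : Type*}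
    (t : G →* Equiv.Perm S) {n : ℕ}
    (h : ∀ s, ∃ L : Subgroup G, (∀ g, g ∈ L ↔ t g s = s) ∧ Acyclic R (a.comp L.subtype) n)
    {A : Type max u v} [AddCommGroup A] [Module R A] (ρ : Representation R G A) {b : ℕ}
    (hb : n < b) (f : S → (Fin (b + 1) → Y) → A)
    (hf : ∀ g s y, f (t g s) (powAct a (b + 1) g y) = ρ g (f s y)) (hd : ∀ s, cobd (f s) = 0) :
    ∃ k : S → (Fin b → Y) → A, (∀ g s y, k (t g s) (powAct a b g y) = ρ g (k s y)) ∧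
      ∀ s, cobd (k s) = f s := by
  have hinv : ∀ g s (k : (Fin b → Y) → A), cobd k = f s →
      cobd (funAct (powAct a b) ρ g k) = f (t g s) := by
    intro g s k hk
    ext y
    have : y = powAct a (b + 1) g (powAct a (b + 1) g⁻¹ y) := by simp
    rw [this, hf, ← hk, ← this]
    simp only [cobd_apply, funAct_apply, map_sum, map_zsmul, powAct_removeNth]
  -- Equivariance over the stabiliser of `s` means being fixed by it under `funAct`, which is what
  -- the choice along orbits requires.
  have hex : ∀ s, ∃ k : (Fin b → Y) → A, cobd k = f s ∧
      ∀ g, t g s = s → funAct (powAct a b) ρ g k = k := by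
    intro s
    obtain ⟨L, hL, hac⟩ := h s
    obtain ⟨k, hk, hk'⟩ := hac A (ρ.comp L.subtype) b hb (f s) (fun g y => by
      have := hf g s y
      rw [(hL g).1 g.2] at this
      exact this) (hd s)
    refine ⟨k, hk', fun g hg => ?_⟩
    ext y
    have := hk ⟨g, (hL g).2 hg⟩ (powAct a b g⁻¹ y)
    rw [funAct_apply]
    refine this.symm.trans ?_
    exact congrArg k (by simp : powAct a b g (powAct a b g⁻¹ y) = y)
  obtain ⟨k, hk, hk'⟩ := exists_equivariant_section t (funAct (powAct a b) ρ)
    (fun s k => cobd k = f s) hinv hex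
  refine ⟨k, fun g s y => ?_, hk'⟩
  rw [hk, funAct_apply]
  simp

end Acyclic

/-! ### Extension along `𝔉`-split maps -/

section Resolution

variable {R : Type u} [CommRing R] {G Q : Type*} [Group G] [Group Q]

/-- A representation as a group of permutations. -/
def repPerm {A : Type*} [AddCommGroup A] [Module R A] (ρ : Representation R G A) :
    G →* Equiv.Perm A where
  toFun g :=
    { toFun := ρ g
      invFun := ρ g⁻¹
      left_inv := fun f => by simp
      right_inv := fun f => by simp }
  map_one' := by ext; simp
  map_mul' g h := by ext; simp

@[simp] lemma repPerm_apply {A : Type*} [AddCommGroup A] [Module R A] (ρ : Representation R G A)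
    (g : G) (x : A) : repPerm ρ g x = ρ g x := rfl

/-- The representation of `G` on `Hom_R(V, A)`, where `G` acts on `V` through `π`. -/
abbrev homRep (π : G →* Q) {V A : Type*} [AddCommGroup V] [Module R V] [AddCommGroup A]
    [Module R A] (σ : Representation R Q V) (ρ : Representation R G A) :
    Representation R G (V →ₗ[R] A) :=
  Representation.linHom (σ.comp π) ρ

lemma homRep_apply (π : G →* Q) {V A : Type*} [AddCommGroup V] [Module R V] [AddCommGroup A]
    [Module R A] (σ : Representation R Q V) (ρ : Representation R G A) (g : G) (f : V →ₗ[R] A)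
    (x : V) : homRep π σ ρ g f x = ρ g (f (σ (π g)⁻¹ x)) := by
  simp [Representation.linHom_apply]

variable (π : G →* Q)

/-- Families of homomorphisms that are equivariant over a `G`-set with finite stabilisers extend
along `𝔉`-split maps. -/
lemma exists_equivariant_extension {V W A : Type*} [AddCommGroup V] [Module R V]
    [AddCommGroup W] [Module R W] [AddCommGroup A] [Module R A] {σ : Representation R Q V}
    {τ : Representation R Q W} {ρ : Representation R G A} (d : σ.IntertwiningMap τ)
    (hd : IsFSplit d) {Z : Type*} {z : G →* Equiv.Perm Z} (hz : ∀ x, {g | z g x = x}.Finite)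
    (f : Z → V →ₗ[R] A) (hf : IsEquivariant z (homRep π σ ρ) f)
    (hker : ∀ x v, d v = 0 → f x v = 0) :
    ∃ k : Z → W →ₗ[R] A, IsEquivariant z (homRep π τ ρ) k ∧ ∀ x v, k x (d v) = f x v := by
  refine exists_equivariant_section z (repPerm (homRep π τ ρ))
    (fun x k => ∀ v, k (d v) = f x v) ?_ ?_
  · intro g x k hk v
    rw [hf, repPerm_apply, homRep_apply, homRep_apply, ← d.isIntertwining, hk]
  · intro x
    let K : Subgroup G :=
      { carrier := {g | z g x = x}
        one_mem' := by simp
        mul_mem' := fun {g h} hg hh => by simp_all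
        inv_mem' := fun {g} hg => by
          have : z g⁻¹ (z g x) = x := by simp
          rwa [hg] at this }
    have hK : Finite K := hz x
    -- The image in `Q` of the finite stabiliser is finite, so `d` splits over it. Then `f x ∘ s` is
    -- fixed by the stabiliser, and it extends `f x` because `f x` kills the kernel of `d`.
    obtain ⟨s, hs⟩ := hd (K.map π) (Set.Finite.image π (hz x))
    refine ⟨f x ∘ₗ s.toLinearMap, fun v => ?_, fun g hg => ?_⟩
    · have h1 : d (s (d v) - v) = 0 := by rw [map_sub, hs, sub_self]
      have h2 := hker x _ h1
      rw [map_sub, sub_eq_zero] at h2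
      exact h2
    · ext w
      rw [repPerm_apply, homRep_apply]
      have hgK : g⁻¹ ∈ K := K.inv_mem hg
      have h1 := s.isIntertwining _ _ ⟨π g⁻¹, Subgroup.mem_map_of_mem π hgK⟩ w
      have h2 := congrArg (fun φ => φ (s w)) (hf g x)
      simp only [hg, homRep_apply] at h2
      rw [LinearMap.comp_apply, LinearMap.comp_apply]
      refine Eq.trans ?_ h2.symm
      congr 2
      rw [← map_inv]
      exact h1

lemma stab_comap {S : Type*} [MulAction Q S] (s : S) (g : G) :
    g ∈ (MulAction.stabilizer Q s).comap π ↔ ((MulAction.toPermHom Q S).comp π) g s = s := by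
  simp [MulAction.mem_stabilizer_iff]

lemma finite_stabilizer_delta (x : Delta Q) : Finite (MulAction.stabilizer Q x) := by
  obtain ⟨H, y⟩ := x
  obtain ⟨q, rfl⟩ := QuotientGroup.mk_surjective y
  have hH : Finite H.1 := H.2
  refine Set.Finite.subset (Set.Finite.image (fun h => q * h * q⁻¹) (Set.toFinite (H.1 : Set Q)))
    fun g hg => ?_
  have h1 : g • (⟨H, (q : Q ⧸ H.1)⟩ : Delta Q) = ⟨H, (q : Q ⧸ H.1)⟩ := hg
  have h2 : ((g * q : Q) : Q ⧸ H.1) = (q : Q ⧸ H.1) := eq_of_heq (Sigma.mk.inj h1).2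
  refine ⟨q⁻¹ * (g * q), QuotientGroup.eq.1 h2.symm, by group⟩

end Resolution

/-! ### The double complex of a resolution over the quotient -/

section Columns

lemma tensor_hom_ext {R : Type*} [CommRing R] {M A : Type*} [AddCommGroup M] [Module R M]
    [AddCommGroup A] [Module R A] {D : Type*} {f g : TensorProduct R M (MonoidAlgebra R D) →ₗ[R] A}
    (h : ∀ m δ, f (m ⊗ₜ MonoidAlgebra.single δ 1) = g (m ⊗ₜ MonoidAlgebra.single δ 1)) :
    f = g := by
  refine TensorProduct.ext' fun m x => ?_
  induction x using MonoidAlgebra.induction_linear with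
  | zero => simp
  | add x y hx hy => simp only [TensorProduct.tmul_add, map_add, hx, hy]
  | single δ r =>
    have : (MonoidAlgebra.single δ r : MonoidAlgebra R D) = r • MonoidAlgebra.single δ 1 := by
      simp
    rw [this, TensorProduct.tmul_smul, map_smul, map_smul, h]

variable {R : Type u} [CommRing R] {Q : Type v} {G : Type*} [Group G] [Group Q] (π : G →* Q)
  {Y : Type v} {a : G →* Equiv.Perm Y}

/-- Maps `M ⊗ RΔ → A` are families of maps `M → A` indexed by `Δ`, whose points have finite
stabilisers in `Q`; Shapiro's lemma applies. For a summand, extend by `p`, solve, and restrict along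
`ι`. -/
lemma exists_cobd_eq_of_isFProjective {n : ℕ}
    (hfin : ∀ F : Subgroup Q, Finite F → Acyclic R (a.comp (F.comap π).subtype) n)
    {P : Rep.{max u v} R Q} (hP : IsFProjective P)
    {A : Type max u v} [AddCommGroup A] [Module R A] {ρ : Representation R G A} {b : ℕ}
    (hb : n < b) (f : (Fin (b + 1) → Y) → P.V →ₗ[R] A)
    (hf : IsEquivariant (powAct a (b + 1)) (homRep π P.ρ ρ) f) (hd : cobd f = 0) :
    ∃ k : (Fin b → Y) → P.V →ₗ[R] A, IsEquivariant (powAct a b) (homRep π P.ρ ρ) k ∧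
      cobd k = f := by
  obtain ⟨M, ⟨r⟩⟩ := hP
  let ι : P.V →ₗ[R] _ := r.i.hom.toLinearMap
  let p : TensorProduct R M.V (MonoidAlgebra R (Delta Q)) →ₗ[R] P.V := r.r.hom.toLinearMap
  have hpι : ∀ x, p (ι x) = x := fun x => by
    have := congrArg (fun φ => φ.hom x) r.retract
    exact this
  have hι : ∀ g x, ι (P.ρ g x) = (M.ρ.tprod (permDelta R Q)) g (ι x) :=
    fun g x => r.i.hom.isIntertwining _ _ g x
  have hp : ∀ g x, p ((M.ρ.tprod (permDelta R Q)) g x) = P.ρ g (p x) :=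
    fun g x => r.r.hom.isIntertwining _ _ g x
  let F : Delta Q → (Fin (b + 1) → Y) → M.V →ₗ[R] A := fun δ y =>
    f y ∘ₗ p ∘ₗ (TensorProduct.mk R _ _).flip (MonoidAlgebra.single δ 1)
  have hF : ∀ g δ y, F (((MulAction.toPermHom Q (Delta Q)).comp π) g δ) (powAct a (b + 1) g y) =
      homRep π M.ρ ρ g (F δ y) := by
    intro g δ y
    ext m
    rw [homRep_apply]
    simp only [F, LinearMap.comp_apply, hf g y]
    rw [homRep_apply, ← hp]
    simp [Representation.tprod_apply, Representation.ofMulAction_single]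
  have hdF : ∀ δ, cobd (F δ) = 0 := by
    intro δ
    ext y m
    have h1 := map_cobd (LinearMap.applyₗ (R := R)
      (p (m ⊗ₜ[R] (MonoidAlgebra.single δ 1 : MonoidAlgebra R (Delta Q)))) :
      _ →ₗ[R] A).toAddMonoidHom f y
    have h2 := map_cobd (LinearMap.applyₗ (R := R) m : _ →ₗ[R] A).toAddMonoidHom (F δ) y
    rw [hd] at h1
    refine h2.trans (h1.symm.trans ?_)
    simp
  obtain ⟨k, hk, hk'⟩ := exists_cobd_eq_of_stabilizers (R := R) (a := a)
    ((MulAction.toPermHom Q (Delta Q)).comp π) (n := n)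
    (fun s => ⟨_, stab_comap π s, hfin _ (finite_stabilizer_delta s)⟩)
    (homRep π M.ρ ρ) hb F hF hdF
  let k' : (Fin b → Y) → TensorProduct R M.V (MonoidAlgebra R (Delta Q)) →ₗ[R] A := fun y =>
    TensorProduct.lift ((Finsupp.linearCombination R (fun δ => k δ y) ∘ₗ
      (MonoidAlgebra.coeffLinearEquiv R).toLinearMap).flip)
  have hk'1 : ∀ y m δ, k' y (m ⊗ₜ MonoidAlgebra.single δ 1) = k δ y m := by
    intro y m δ
    simp [k']
  refine ⟨fun y => k' y ∘ₗ ι, fun g y => ?_, ?_⟩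
  · have key : k' (powAct a b g y) = ρ g ∘ₗ k' y ∘ₗ (M.ρ.tprod (permDelta R Q)) (π g)⁻¹ := by
      refine tensor_hom_ext fun m δ => ?_
      have h1 := hk g (π g⁻¹ • δ) y
      simp only [MonoidHom.comp_apply, MulAction.toPermHom_apply, MulAction.toPerm_apply,
        smul_smul, ← map_mul, mul_inv_cancel, map_one, one_smul] at h1
      simp [hk'1, h1, Representation.tprod_apply, Representation.ofMulAction_single]
    ext x
    rw [homRep_apply, LinearMap.comp_apply, key, LinearMap.comp_apply]
    exact congrArg (fun w => ρ g (k' y w)) (hι (π g)⁻¹ x).symm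
  · have key : ∀ y, cobd k' y = f y ∘ₗ p := by
      intro y
      refine tensor_hom_ext fun m δ => ?_
      have h1 := map_cobd (LinearMap.applyₗ (R := R)
        (m ⊗ₜ[R] (MonoidAlgebra.single δ 1 : MonoidAlgebra R (Delta Q))) :
        _ →ₗ[R] A).toAddMonoidHom k' y
      have h2 := map_cobd (LinearMap.applyₗ (R := R) m : _ →ₗ[R] A).toAddMonoidHom (k δ) y
      rw [hk'] at h2
      refine h1.trans (Eq.trans ?_ h2.symm)
      exact congrArg (fun φ => cobd φ y) (funext fun z => hk'1 z m δ)
    ext y x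
    have h1 := map_cobd (LinearMap.lcomp R A ι).toAddMonoidHom k' y
    refine (congrArg (fun φ => φ x) h1.symm).trans ?_
    change cobd k' y (ι x) = _
    rw [key, LinearMap.comp_apply, hpι]

end Columns

section Precomp

variable {R : Type u} [CommRing R] {G Q : Type*} [Group G] [Group Q] {π : G →* Q}
  {V W A : Type*} [AddCommGroup V] [Module R V] [AddCommGroup W] [Module R W] [AddCommGroup A]
  [Module R A] {σ : Representation R Q V} {τ : Representation R Q W} {ρ : Representation R G A}
  (d : σ.IntertwiningMap τ)

lemma IsEquivariant.precomp {Z : Type*} {z : G →* Equiv.Perm Z} {f : Z → W →ₗ[R] A}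
    (hf : IsEquivariant z (homRep π τ ρ) f) :
    IsEquivariant z (homRep π σ ρ) (fun x => f x ∘ₗ d.toLinearMap) := by
  intro g x
  ext v
  rw [homRep_apply]
  simp only [hf g x, LinearMap.comp_apply, homRep_apply,
    Representation.IntertwiningMap.toLinearMap_apply]
  rw [d.isIntertwining]

lemma cobd_precomp {Y : Type*} {n : ℕ} (f : (Fin n → Y) → W →ₗ[R] A) :
    cobd (fun y => f y ∘ₗ d.toLinearMap) = fun y => cobd f y ∘ₗ d.toLinearMap := by
  ext1 y
  exact (map_cobd (LinearMap.lcomp R A d.toLinearMap).toAddMonoidHom f y).symm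

end Precomp

section Chase

variable {R : Type u} [CommRing R] {Q : Type v} {G : Type*} [Group G] [Group Q] {π : G →* Q}
  {Y : Type v} {a : G →* Equiv.Perm Y}

/-- The columns `Hom_R(Z_i, A)` of cocycles, where `Z_i` is the `i`-th syzygy, are acyclic above
degree `n + e` if the resolution ends in degree `i + e`. -/
lemma exists_cobd_eq_of_syzygy {n : ℕ} (hY : ∀ y, {g | a g y = y}.Finite)
    (hfin : ∀ F : Subgroup Q, Finite F → Acyclic R (a.comp (F.comap π).subtype) n)
    (X : FResolution (Representation.trivial R Q R))
    {A : Type max u v} [AddCommGroup A] [Module R A] {ρ : Representation R G A} (e : ℕ) :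
    ∀ i, X.LengthLE (i + e) → ∀ b, n + e < b → ∀ x : (Fin (b + 1) → Y) → (X.P i).V →ₗ[R] A,
      IsEquivariant (powAct a (b + 1)) (homRep π (X.P i).ρ ρ) x →
      (∀ y, x y ∘ₗ (X.d i).toLinearMap = 0) → cobd x = 0 →
      ∃ k : (Fin b → Y) → (X.P i).V →ₗ[R] A, IsEquivariant (powAct a b) (homRep π (X.P i).ρ ρ) k ∧
        (∀ y, k y ∘ₗ (X.d i).toLinearMap = 0) ∧ cobd k = x := by
  induction e with
  | zero =>
    intro i hi b hb x hx _ hdx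
    obtain ⟨k, hk, hk'⟩ := exists_cobd_eq_of_isFProjective π hfin (X.fProjective i) hb x hx hdx
    refine ⟨k, hk, fun y => ?_, hk'⟩
    have := hi (i + 1) (by omega)
    ext v
    rw [Subsingleton.elim v 0, map_zero, map_zero]
  | succ e ih =>
    intro i hi b hb x hx hx0 hdx
    obtain ⟨k, hk, hk'⟩ := exists_cobd_eq_of_isFProjective π hfin (X.fProjective i)
      (by omega : n < b) x hx hdx
    -- With `b ≥ 2`, the cochain `z` below lives on nonempty tuples, which have finite stabilisers.
    -- It solves the problem for `k ∘ d`, one column further and one degree lower.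
    obtain ⟨b, rfl⟩ : ∃ c, b = c + 2 := ⟨b - 2, by omega⟩
    obtain ⟨z, hz, hz0, hz'⟩ := ih (i + 1) (by rwa [add_assoc, add_comm 1 e]) (b + 1) (by omega)
      (fun y => k y ∘ₗ (X.d i).toLinearMap) (hk.precomp _) (fun y => by
        ext v
        simp [(X.exact_succ i).apply_apply_eq_zero]) (by
        rw [cobd_precomp, hk']; ext1 y; exact hx0 y)
    obtain ⟨w, hw, hw'⟩ := exists_equivariant_extension π (X.d i) (X.fSplit_d i)
      (finite_stab_powAct hY) z hz (fun y v hv => by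
        obtain ⟨v', rfl⟩ := (X.exact_succ i v).1 hv
        exact congrArg (fun φ => φ v') (hz0 y))
    have hw'' : (fun y => w y ∘ₗ (X.d i).toLinearMap) = z := by
      ext y v; exact hw' y v
    refine ⟨k - cobd w, hk.sub hw.cobd, fun y => ?_, ?_⟩
    · have h1 := congrFun (cobd_precomp (X.d i) w) y
      rw [hw'', hz'] at h1
      rw [Pi.sub_apply, LinearMap.sub_comp, sub_eq_zero]
      exact h1
    · rw [map_sub, cobd_cobd, sub_zero, hk']

/-- Acyclicity passes from the preimages of the finite subgroups of `Q` to the whole group. -/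
theorem acyclic_of_fResolution {n q : ℕ} (hY : ∀ y, {g | a g y = y}.Finite)
    (hfin : ∀ F : Subgroup Q, Finite F → Acyclic R (a.comp (F.comap π).subtype) n)
    (X : FResolution (Representation.trivial R Q R)) (hX : X.LengthLE q) :
    Acyclic R a (n + q) := by
  intro A _ _ ρ b hb f hf hd
  obtain ⟨b, rfl⟩ : ∃ c, b = c + 1 := ⟨b - 1, by omega⟩
  -- Identifying `A` with `Hom_R(R, A)` puts `f` into the augmentation column.
  let f' : (Fin (b + 2) → Y) → R →ₗ[R] A := fun y => LinearMap.toSpanSingleton R A (f y)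
  have hf' : IsEquivariant (powAct a (b + 2)) (homRep π (Representation.trivial R Q R) ρ) f' := by
    intro g y
    ext
    rw [homRep_apply]
    simp [f', hf g y]
  have hdf' : cobd f' = 0 := by
    ext y
    have h1 := map_cobd (LinearMap.applyₗ (R := R) (1 : R) : _ →ₗ[R] A).toAddMonoidHom f' y
    refine h1.trans ?_
    have h2 : (fun z => (LinearMap.applyₗ (R := R) (1 : R) : _ →ₗ[R] A).toAddMonoidHom (f' z))
        = f := by
      ext z; simp [f']
    rw [h2, hd]
    simp
  obtain ⟨z, hz, hz0, hz'⟩ := exists_cobd_eq_of_syzygy (ρ := ρ) hY hfin X q 0 (by simpa using hX)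
    (b + 1) hb (fun y => f' y ∘ₗ X.ε.toLinearMap) (hf'.precomp _) (fun y => by
      ext v
      simp [X.exact_zero.apply_apply_eq_zero]) (by
      rw [cobd_precomp, hdf']; rfl)
  obtain ⟨w, hw, hw'⟩ := exists_equivariant_extension π X.ε X.fSplit_ε
    (finite_stab_powAct hY) z hz (fun y v hv => by
      obtain ⟨v', rfl⟩ := (X.exact_zero v).1 hv
      exact congrArg (fun φ => φ v') (hz0 y))
  refine ⟨fun y => w y 1, fun g y => ?_, ?_⟩
  · simp only [hw g y, homRep_apply]
    simp
  · ext y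
    obtain ⟨v, hv⟩ := X.surjective_ε 1
    have h1 := congrFun (cobd_precomp X.ε w) y
    have hw'' : (fun y => w y ∘ₗ X.ε.toLinearMap) = z := by
      ext y v; exact hw' y v
    rw [hw'', hz'] at h1
    have h2 := congrArg (fun φ => φ v) h1
    have h3 := map_cobd (LinearMap.applyₗ (R := R) (1 : R) : _ →ₗ[R] A).toAddMonoidHom w y
    refine h3.symm.trans ?_
    change cobd w y 1 = _
    have h4 : cobd w y (X.ε v) = f' y (X.ε v) := h2.symm
    rw [hv] at h4
    rw [h4]
    simp [f']

variable (R) in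
/-- There is an `𝔉`-split resolution of the trivial module of length at most `n`. -/
def HasFResolution (G : Type v) [Group G] (n : ℕ) : Prop :=
  ∃ X : FResolution (Representation.trivial R G R), X.LengthLE n

/-- Preimages of finite subgroups under an injection are finite, so they fix a point of `Y` and
contribute dimension `0`. Allowing injections instead of the identity covers subgroups. -/
lemma HasFResolution.acyclic {q : ℕ} (h : HasFResolution R Q q) (hπ : Function.Injective π)
    (ha : IsProperUniversal a) : Acyclic R a q := by
  obtain ⟨X, hX⟩ := h
  rw [← zero_add q]
  refine acyclic_of_fResolution (π := π) ha.finite_stab (fun F hF => ?_) X hX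
  have hfin : Finite (F.comap π) :=
    (Set.toFinite (F : Set Q)).preimage (f := π) hπ.injOn
  obtain ⟨y, hy⟩ := ha.exists_fixed (F.comap π) hfin
  exact acyclic_of_fixed (a := a.comp (F.comap π).subtype) (y₀ := y) (fun g => hy g g.2) 0

end Chase

/-! ### Chains, cones and the universal cocycle -/

section Chains

variable {R : Type u} [CommRing R] {G : Type*} [Group G]

/-- The permutation representation on finitely supported functions. -/
noncomputable def permRep {Z : Type*} (z : G →* Equiv.Perm Z) : Representation R G (Z →₀ R) where
  toFun g := Finsupp.lmapDomain R R (z g)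
  map_one' := by ext; simp
  map_mul' g h := by ext; simp

lemma permRep_single {Z : Type*} (z : G →* Equiv.Perm Z) (g : G) (x : Z) (r : R) :
    permRep z g (Finsupp.single x r) = Finsupp.single (z g x) r := by
  simp [permRep]

lemma isEquivariant_single {Z : Type*} (z : G →* Equiv.Perm Z) :
    IsEquivariant z (permRep (R := R) z) (fun x => Finsupp.single x 1) :=
  fun g x => (permRep_single z g x 1).symm

lemma linearCombination_permRep {Z A : Type*} [AddCommGroup A] [Module R A]
    {z : G →* Equiv.Perm Z} {ρ : Representation R G A} {f : Z → A} (hf : IsEquivariant z ρ f)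
    (g : G) (c : Z →₀ R) :
    Finsupp.linearCombination R f (permRep z g c) = ρ g (Finsupp.linearCombination R f c) := by
  have : Finsupp.linearCombination R f ∘ₗ permRep z g = ρ g ∘ₗ Finsupp.linearCombination R f := by
    ext x; simp [permRep_single, hf g x]
  exact congrArg (fun φ => φ c) this

variable {Y : Type*}

/-- The boundary map on chains. -/
noncomputable def bd (R : Type u) [CommRing R] (Y : Type*) (n : ℕ) :
    ((Fin (n + 1) → Y) →₀ R) →ₗ[R] ((Fin n → Y) →₀ R) :=
  Finsupp.linearCombination R (cobd fun y => Finsupp.single y 1)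

lemma bd_single {n : ℕ} (y : Fin (n + 1) → Y) :
    bd R Y n (Finsupp.single y 1) = cobd (fun y => Finsupp.single y 1) y := by
  simp [bd]

lemma linearCombination_bd {A : Type*} [AddCommGroup A] [Module R A] {n : ℕ} (f : (Fin n → Y) → A)
    (c : (Fin (n + 1) → Y) →₀ R) :
    Finsupp.linearCombination R f (bd R Y n c) = Finsupp.linearCombination R (cobd f) c := by
  have : Finsupp.linearCombination R f ∘ₗ bd R Y n = Finsupp.linearCombination R (cobd f) := by
    ext y
    have h := map_cobd (Finsupp.linearCombination R f).toAddMonoidHom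
      (fun y => Finsupp.single y (1 : R)) y
    simp only [LinearMap.comp_apply, Finsupp.lsingle_apply, bd_single]
    refine h.trans ?_
    simp
  exact congrArg (fun φ => φ c) this

lemma bd_bd {n : ℕ} (c : (Fin (n + 2) → Y) →₀ R) : bd R Y n (bd R Y (n + 1) c) = 0 := by
  rw [show bd R Y n (bd R Y (n + 1) c) = _ from linearCombination_bd _ c, cobd_cobd]
  simp

lemma bd_permRep (a : G →* Equiv.Perm Y) {n : ℕ} (g : G) (c : (Fin (n + 1) → Y) →₀ R) :
    bd R Y n (permRep (powAct a (n + 1)) g c) = permRep (powAct a n) g (bd R Y n c) :=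
  linearCombination_permRep (isEquivariant_single _).cobd g c

/-- The cone operator with apex `x`. -/
noncomputable def cone (R : Type u) [CommRing R] {Y : Type*} (n : ℕ) (x : Y) :
    ((Fin n → Y) →₀ R) →ₗ[R] ((Fin (n + 1) → Y) →₀ R) :=
  Finsupp.linearCombination R fun y => Finsupp.single (Fin.cons x y) 1

lemma bd_cone {n : ℕ} (x : Y) (c : (Fin (n + 1) → Y) →₀ R) :
    bd R Y (n + 1) (cone R (n + 1) x c) = c - cone R n x (bd R Y n c) := by
  have : bd R Y (n + 1) ∘ₗ cone R (n + 1) x = LinearMap.id - cone R n x ∘ₗ bd R Y n := by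
    ext1 y
    ext1
    have h := map_cobd (cone R n x).toAddMonoidHom (fun y => Finsupp.single y (1 : R)) y
    simp only [LinearMap.comp_apply, Finsupp.lsingle_apply, LinearMap.sub_apply, bd_single,
      LinearMap.id_apply]
    have h2 : cone R n x (cobd (fun y => Finsupp.single y (1 : R)) y)
        = cobd (fun z => Finsupp.single (Fin.cons x z) (1 : R)) y := by
      refine h.trans ?_
      simp [cone]
    rw [h2]
    refine Eq.trans ?_ (cobd_cons (fun y => Finsupp.single y (1 : R)) x y)
    rw [← bd_single]
    simp [cone]
  exact congrArg (fun φ => φ c) this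

lemma cone_permRep (a : G →* Equiv.Perm Y) {n : ℕ} (g : G) (x : Y) (c : (Fin n → Y) →₀ R) :
    cone R n (a g x) (permRep (powAct a n) g c) = permRep (powAct a (n + 1)) g (cone R n x c) := by
  have : cone R n (a g x) ∘ₗ permRep (powAct a n) g
      = permRep (powAct a (n + 1)) g ∘ₗ cone R n x := by
    ext1 y
    ext1
    simp [permRep_single, cone, powAct_cons]
  exact congrArg (fun φ => φ c) this

lemma bd_eq_zero_iff [Nonempty Y] {n : ℕ} (c : (Fin (n + 1) → Y) →₀ R) :
    bd R Y n c = 0 ↔ ∃ c', bd R Y (n + 1) c' = c := by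
  constructor
  · intro h
    obtain ⟨x⟩ := ‹Nonempty Y›
    exact ⟨cone R (n + 1) x c, by rw [bd_cone, h, map_zero, sub_zero]⟩
  · rintro ⟨c', rfl⟩
    exact bd_bd c'

end Chains

section Retraction

variable {R : Type u} [CommRing R] {G : Type*} [Group G] {Y : Type v} {a : G →* Equiv.Perm Y}

/-- The tautological cocycle `y ↦ bd y`, with the boundaries themselves as coefficients, is the
coboundary of some `r`; this says that `r` retracts the chains onto the boundaries. -/
lemma Acyclic.exists_retraction {n b : ℕ} (h : Acyclic R a n) (hb : n < b) :
    ∃ r : (Fin b → Y) → ((Fin b → Y) →₀ R), IsEquivariant (powAct a b) (permRep (powAct a b)) r ∧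
      (∀ y, r y ∈ LinearMap.range (bd R Y b)) ∧
      ∀ c, Finsupp.linearCombination R r (bd R Y b c) = bd R Y b c := by
  let W := LinearMap.range (bd R Y b)
  let ρ : Representation R G W := (permRep (powAct a b)).subrepresentation W (by
    rintro g _ ⟨c, rfl⟩
    exact ⟨permRep (powAct a (b + 1)) g c, bd_permRep a g c⟩)
  let f : (Fin (b + 1) → Y) → W := fun y => ⟨bd R Y b (Finsupp.single y 1), ⟨_, rfl⟩⟩
  obtain ⟨r, hr, hr'⟩ := h W ρ b hb f (fun g y => Subtype.ext (by
      change bd R Y b _ = permRep (powAct a b) g _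
      rw [← permRep_single, bd_permRep]
      rfl)) (by
    ext1 y
    refine Subtype.ext ?_
    refine (map_cobd W.subtype.toAddMonoidHom f y).trans ?_
    have : (fun z => W.subtype.toAddMonoidHom (f z)) = cobd fun y => Finsupp.single y (1 : R) := by
      ext1 z; exact bd_single z
    rw [this, cobd_cobd]
    rfl)
  refine ⟨fun y => r y, fun g y => congrArg Subtype.val (hr g y), fun y => (r y).2, fun c => ?_⟩
  rw [linearCombination_bd]
  have : cobd (fun y => (r y : (Fin b → Y) →₀ R)) = cobd fun y => Finsupp.single y (1 : R) := by
    ext1 y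
    refine (map_cobd W.subtype.toAddMonoidHom r y).symm.trans ?_
    rw [hr']
    exact bd_single y
  rw [this]
  rfl

end Retraction

/-! ### `𝔉`-projective permutation modules and truncation -/

section FProjective

variable {R : Type u} [CommRing R] {G : Type v} [Group G]

lemma exists_equivariant_delta {Z : Type*} {z : G →* Equiv.Perm Z}
    (hz : ∀ x, {g | z g x = x}.Finite) : ∃ τ : Z → Delta G, ∀ g x, τ (z g x) = g • τ x := by
  obtain ⟨τ, hτ, -⟩ := exists_equivariant_section z (MulAction.toPermHom G (Delta G))
    (fun _ _ => True) (fun _ _ _ _ => trivial) (fun x => by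
      let K : Subgroup G :=
        { carrier := {g | z g x = x}
          one_mem' := by simp
          mul_mem' := fun {g h} hg hh => by simp_all
          inv_mem' := fun {g} hg => by
            have : z g⁻¹ (z g x) = x := by simp
            rwa [hg] at this }
      have hK : Finite K := hz x
      refine ⟨⟨⟨K, hK⟩, (1 : G)⟩, trivial, fun g hg => ?_⟩
      have : g • ((1 : G) : G ⧸ K) = ((1 : G) : G ⧸ K) :=
        QuotientGroup.eq.2 (by simpa using K.inv_mem hg)
      exact congrArg (Sigma.mk (β := fun H : {H : Subgroup G // Finite H} => G ⧸ H.1) ⟨K, hK⟩) this)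
  exact ⟨τ, hτ⟩

lemma isFProjective_of_retract {V M : Type max u v} [AddCommGroup V] [Module R V]
    [AddCommGroup M] [Module R M] (ρ : Representation R G V) (μ : Representation R G M)
    (i : ρ.IntertwiningMap (μ.tprod (permDelta R G)))
    (r : (μ.tprod (permDelta R G)).IntertwiningMap ρ) (h : ∀ x, r (i x) = x) :
    IsFProjective (Rep.of ρ) :=
  ⟨Rep.of μ, ⟨⟨Rep.ofHom i, Rep.ofHom r, by ext x; exact h x⟩⟩⟩

/-- A permutation module with finite stabilisers is a direct summand of its tensor product
with `RΔ`. -/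
lemma exists_retract_tprod_permDelta {Z : Type v} {z : G →* Equiv.Perm Z}
    (hz : ∀ x, {g | z g x = x}.Finite) :
    ∃ (i : (permRep (R := R) z).IntertwiningMap ((permRep z).tprod (permDelta R G)))
      (r : ((permRep z).tprod (permDelta R G)).IntertwiningMap (permRep (R := R) z)),
      ∀ c, r (i c) = c := by
  obtain ⟨τ, hτ⟩ := exists_equivariant_delta hz
  -- The map `x ↦ x ⊗ τ x` is equivariant and is split by the augmentation of `RΔ`.
  let i₀ : (Z →₀ R) →ₗ[R] TensorProduct R (Z →₀ R) (MonoidAlgebra R (Delta G)) :=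
    Finsupp.linearCombination R fun x =>
      Finsupp.single x (1 : R) ⊗ₜ[R] MonoidAlgebra.single (τ x) (1 : R)
  let aug : MonoidAlgebra R (Delta G) →ₗ[R] R :=
    Finsupp.linearCombination R (fun _ => (1 : R)) ∘ₗ
      (MonoidAlgebra.coeffLinearEquiv R).toLinearMap
  let r₀ : TensorProduct R (Z →₀ R) (MonoidAlgebra R (Delta G)) →ₗ[R] (Z →₀ R) :=
    (TensorProduct.rid R _).toLinearMap ∘ₗ LinearMap.lTensor _ aug
  refine ⟨⟨i₀, fun g => ?_⟩, ⟨r₀, fun g => ?_⟩, fun c => ?_⟩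
  · ext1 x
    ext1
    simp only [LinearMap.comp_apply, Finsupp.lsingle_apply, permRep_single, i₀,
      Finsupp.linearCombination_single, one_smul, Representation.tprod_apply,
      TensorProduct.map_tmul, Representation.ofMulAction_single, hτ]
  · refine tensor_hom_ext fun m δ => ?_
    simp [r₀, aug, Representation.tprod_apply, Representation.ofMulAction_single]
  · have : r₀ ∘ₗ i₀ = LinearMap.id := by
      ext1 x
      ext1
      simp [r₀, i₀, aug]
    exact congrArg (fun φ => φ c) this

end FProjective

open CategoryTheory

section Truncation

variable {R : Type u} [CommRing R] {G : Type v} [Group G]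

lemma IsFProjective.of_retract {P P' : Rep.{max u v} R G} (h : IsFProjective P)
    (r : Retract P' P) : IsFProjective P' := by
  obtain ⟨M, ⟨r'⟩⟩ := h
  exact ⟨M, ⟨r.trans r'⟩⟩

/-- The quotient by an equivariantly complemented submodule is `𝔉`-projective. -/
lemma IsFProjective.quotient {P : Rep.{max u v} R G} (h : IsFProjective P)
    (W : Submodule R P.V) (hW : ∀ g, W ≤ W.comap (P.ρ g)) (e : P.ρ.IntertwiningMap P.ρ)
    (heW : ∀ c ∈ W, e c = 0) (heW' : ∀ c, e c - c ∈ W) :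
    IsFProjective (Rep.of (P.ρ.quotient W hW)) := by
  refine h.of_retract ⟨Rep.ofHom ⟨W.liftQ e.toLinearMap heW, fun g => ?_⟩,
    Rep.ofHom ⟨W.mkQ, fun g => rfl⟩, ?_⟩
  · refine LinearMap.ext fun x => ?_
    obtain ⟨c, rfl⟩ := W.mkQ_surjective x
    exact e.isIntertwining _ _ g c
  · ext c
    exact (Submodule.Quotient.eq W).2 (heW' c)

/-- Maps induced on quotients by an `𝔉`-split map are `𝔉`-split, if one divides out nothing
in the target or everything in the source. -/
lemma IsFSplit.mapQ {V V' : Type*} [AddCommGroup V] [Module R V] [AddCommGroup V'] [Module R V']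
    {ρ : Representation R G V} {σ : Representation R G V'} {f : ρ.IntertwiningMap σ}
    (hf : IsFSplit f) (W : Submodule R V) (hW : ∀ g, W ≤ W.comap (ρ g))
    (W' : Submodule R V') (hW' : ∀ g, W' ≤ W'.comap (σ g)) (h : W = ⊤ ∨ W' = ⊥)
    (f' : (ρ.quotient W hW).IntertwiningMap (σ.quotient W' hW'))
    (hf' : ∀ v, f' (W.mkQ v) = W'.mkQ (f v)) : IsFSplit f' := by
  intro H hH
  obtain ⟨s, hs⟩ := hf H hH
  refine ⟨⟨W'.mapQ W s.toLinearMap ?_, fun g => ?_⟩, fun x => ?_⟩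
  -- The partial inverse `s` descends if it carries `W'` into `W`, which is automatic in both cases.
  · rcases h with rfl | rfl
    · simp
    · simp
  · refine LinearMap.ext fun x => ?_
    obtain ⟨c, rfl⟩ := W'.mkQ_surjective x
    exact congrArg W.mkQ (s.isIntertwining _ _ g c)
  · obtain ⟨c, rfl⟩ := W.mkQ_surjective x
    rw [hf']
    refine (hf' (s (f c))).trans ?_
    rw [hs]

namespace FResolution

variable {V : Type w} [AddCommGroup V] [Module R V] {ρ : Representation R G V}
  (X : FResolution ρ) (n : ℕ)

/-- The submodules divided out in the truncation of a resolution in degree `n`. -/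
def truncSubmodule (i : ℕ) : Submodule R (X.P i).V :=
  if i < n then ⊥ else if i = n then LinearMap.range (X.d i).toLinearMap else ⊤

lemma truncSubmodule_le_comap (i : ℕ) (g : G) :
    X.truncSubmodule n i ≤ (X.truncSubmodule n i).comap ((X.P i).ρ g) := by
  unfold truncSubmodule
  split_ifs
  · simp
  · rintro _ ⟨c, rfl⟩
    exact ⟨(X.P (i + 1)).ρ g c, (X.d i).isIntertwining _ _ g c⟩
  · simp

lemma truncSubmodule_eq_top_or (i : ℕ) :
    X.truncSubmodule n (i + 1) = ⊤ ∨ X.truncSubmodule n i = ⊥ := by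
  unfold truncSubmodule
  by_cases h : i < n
  · exact Or.inr (if_pos h)
  · left
    rw [if_neg (by omega), if_neg (by omega)]

lemma truncSubmodule_le_comap_d (i : ℕ) :
    X.truncSubmodule n (i + 1) ≤ (X.truncSubmodule n i).comap (X.d i).toLinearMap := by
  unfold truncSubmodule
  rcases lt_trichotomy (i + 1) n with h | h | h
  · rw [if_pos h]; simp
  · rw [if_neg (by omega), if_pos h, if_pos (by omega)]
    rintro _ ⟨c, rfl⟩
    exact (X.exact_succ i).apply_apply_eq_zero c
  · rw [if_neg (by omega : ¬ i < n)]
    intro c _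
    split_ifs
    · exact ⟨c, rfl⟩
    · trivial

lemma truncSubmodule_le_ker_ε (n : ℕ) :
    X.truncSubmodule n 0 ≤ LinearMap.ker X.ε.toLinearMap := by
  unfold truncSubmodule
  rcases Nat.eq_zero_or_pos n with rfl | h
  · rw [if_neg (by omega), if_pos rfl]
    rintro _ ⟨c, rfl⟩
    exact X.exact_zero.apply_apply_eq_zero c
  · rw [if_pos h]; simp

/-- A resolution can be truncated in degree `n` if the image of the differential into degree `n`
is a direct summand. -/
theorem exists_lengthLE (e : (X.P n).ρ.IntertwiningMap (X.P n).ρ) (he : ∀ c, e (X.d n c) = 0)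
    (he' : ∀ c, e c - c ∈ LinearMap.range (X.d n).toLinearMap) :
    ∃ X' : FResolution ρ, X'.LengthLE n := by
  let W := X.truncSubmodule n
  let hW := X.truncSubmodule_le_comap n
  have hd : ∀ i g, (W (i + 1)).mapQ (W i) (X.d i).toLinearMap (X.truncSubmodule_le_comap_d n i) ∘ₗ
      (X.P (i + 1)).ρ.quotient _ (hW (i + 1)) g =
      (X.P i).ρ.quotient _ (hW i) g ∘ₗ
        (W (i + 1)).mapQ (W i) (X.d i).toLinearMap (X.truncSubmodule_le_comap_d n i) := by
    intro i g
    refine LinearMap.ext fun x => ?_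
    obtain ⟨c, rfl⟩ := (W (i + 1)).mkQ_surjective x
    exact congrArg (W i).mkQ ((X.d i).isIntertwining _ _ g c)
  have hε : ∀ g, (W 0).liftQ X.ε.toLinearMap (X.truncSubmodule_le_ker_ε n) ∘ₗ
      (X.P 0).ρ.quotient _ (hW 0) g =
      ρ g ∘ₗ (W 0).liftQ X.ε.toLinearMap (X.truncSubmodule_le_ker_ε n) := by
    intro g
    refine LinearMap.ext fun x => ?_
    obtain ⟨c, rfl⟩ := (W 0).mkQ_surjective x
    exact X.ε.isIntertwining _ _ g c
  refine ⟨{ P := fun i => Rep.of ((X.P i).ρ.quotient _ (hW i))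
            d := fun i => ⟨_, hd i⟩
            ε := ⟨_, hε⟩
            fProjective := fun i => ?_
            surjective_ε := fun v => ?_
            exact_zero := fun x => ?_
            exact_succ := fun i x => ?_
            fSplit_ε := fun H hH => ?_
            fSplit_d := fun i => ?_ }, fun i hi => ?_⟩
  · rcases lt_trichotomy i n with h | rfl | h
    · refine (X.fProjective i).quotient _ _ (.id _) (fun c hc => ?_) (fun c => ?_)
      · have : c ∈ (⊥ : Submodule R (X.P i).V) := by
          simpa only [truncSubmodule, if_pos h] using hc
        simpa using this
      · simp
    · have hWi : X.truncSubmodule i i = LinearMap.range (X.d i).toLinearMap := by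
        simp [truncSubmodule]
      -- As `e` kills the boundaries and is the identity modulo them, it induces a section of the
      -- quotient map.
      refine (X.fProjective i).quotient _ _ e (fun c hc => ?_) (fun c => ?_)
      · rw [hWi] at hc
        obtain ⟨c', rfl⟩ := hc
        exact he c'
      · rw [hWi]
        exact he' c
    · refine (X.fProjective i).quotient _ _ 0 (fun c hc => rfl) (fun c => ?_)
      have : X.truncSubmodule n i = ⊤ := by
        rw [truncSubmodule, if_neg (by omega), if_neg (by omega)]
      rw [this]
      trivial
  · obtain ⟨c, rfl⟩ := X.surjective_ε v
    exact ⟨(W 0).mkQ c, rfl⟩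
  · obtain ⟨c, rfl⟩ := (W 0).mkQ_surjective x
    constructor
    · intro h
      obtain ⟨c', rfl⟩ := (X.exact_zero c).1 h
      exact ⟨(W 1).mkQ c', rfl⟩
    · rintro ⟨x', hx'⟩
      obtain ⟨c', rfl⟩ := (W 1).mkQ_surjective x'
      rw [← hx']
      exact X.exact_zero.apply_apply_eq_zero c'
  · obtain ⟨c, rfl⟩ := (W (i + 1)).mkQ_surjective x
    constructor
    · intro h
      rcases X.truncSubmodule_eq_top_or n i with h' | h'
      · refine ⟨0, ?_⟩
        rw [map_zero]
        exact ((Submodule.Quotient.mk_eq_zero _).2 (by rw [h']; trivial)).symm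
      · have h1 : X.d i c ∈ X.truncSubmodule n i := (Submodule.Quotient.mk_eq_zero _).1 h
        rw [h', Submodule.mem_bot] at h1
        obtain ⟨c', rfl⟩ := (X.exact_succ i c).1 h1
        exact ⟨(W (i + 2)).mkQ c', rfl⟩
    · rintro ⟨x', hx'⟩
      obtain ⟨c', rfl⟩ := (W (i + 2)).mkQ_surjective x'
      rw [← hx']
      exact congrArg (W i).mkQ ((X.exact_succ i).apply_apply_eq_zero c')
  · obtain ⟨s, hs⟩ := X.fSplit_ε H hH
    refine ⟨⟨(W 0).mkQ ∘ₗ s.toLinearMap, fun g => LinearMap.ext fun x =>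
      congrArg (W 0).mkQ (s.isIntertwining _ _ g x)⟩, fun x => ?_⟩
    obtain ⟨c, rfl⟩ := (W 0).mkQ_surjective x
    exact hs c
  · exact (X.fSplit_d i).mapQ _ _ _ _ (X.truncSubmodule_eq_top_or n i) _ fun v => rfl
  · have : X.truncSubmodule n i = ⊤ := by
      rw [truncSubmodule, if_neg (by omega), if_neg (by omega)]
    exact Submodule.Quotient.subsingleton_iff.2 this

end FResolution

end Truncation

/-! ### The standard resolution -/

section Standard

variable {R : Type u} [CommRing R] {G : Type v} [Group G] {Y : Type v} {a : G →* Equiv.Perm Y}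

variable (R Y) in
/-- The augmentation of the standard complex. -/
noncomputable def augmentation : ((Fin 1 → Y) →₀ R) →ₗ[R] R :=
  Finsupp.linearCombination R fun _ => 1

lemma augmentation_eq_zero_iff (c : (Fin 1 → Y) →₀ R) :
    augmentation R Y c = 0 ↔ bd R Y 0 c = 0 := by
  have h : ∀ c, augmentation R Y c = bd R Y 0 c Fin.elim0 := by
    intro c
    have : augmentation R Y = Finsupp.lapply Fin.elim0 ∘ₗ bd R Y 0 := by
      ext1 y
      ext1
      simp only [LinearMap.comp_apply, Finsupp.lsingle_apply, bd_single,
        cobd_zero_points _ _ Fin.elim0]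
      simp [augmentation]
    exact congrArg (fun φ => φ c) this
  rw [h]
  constructor
  · intro h0
    refine Finsupp.ext fun y => ?_
    rw [Subsingleton.elim y Fin.elim0, h0]
    rfl
  · intro h0
    rw [h0]
    rfl

/-- The standard resolution on a universal proper `G`-set. -/
noncomputable def standardResolution (ha : IsProperUniversal a) :
    FResolution (Representation.trivial R G R) where
  P i := Rep.of (permRep (powAct a (i + 1)))
  d i := ⟨bd R Y (i + 1), fun g => LinearMap.ext fun c => bd_permRep a g c⟩
  ε := ⟨augmentation R Y, fun g => LinearMap.ext fun c =>
    linearCombination_permRep (z := powAct a 1) (ρ := Representation.trivial R G R)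
      (fun g x => rfl) g c⟩
  fProjective i := by
    obtain ⟨j, r, h⟩ := exists_retract_tprod_permDelta (R := R)
      (finite_stab_powAct (n := i) ha.finite_stab)
    exact isFProjective_of_retract _ _ j r h
  surjective_ε r := by
    obtain ⟨y, -⟩ := ha.exists_fixed ⊥ inferInstance
    exact ⟨Finsupp.single (fun _ => y) r, by simp [augmentation]⟩
  exact_zero c := by
    obtain ⟨y, -⟩ := ha.exists_fixed ⊥ inferInstance
    have : Nonempty Y := ⟨y⟩
    exact (augmentation_eq_zero_iff c).trans (bd_eq_zero_iff c)
  exact_succ i c := by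
    obtain ⟨y, -⟩ := ha.exists_fixed ⊥ inferInstance
    have : Nonempty Y := ⟨y⟩
    exact bd_eq_zero_iff c
  fSplit_ε H hH := by
    obtain ⟨y, hy⟩ := ha.exists_fixed H hH
    refine ⟨⟨Finsupp.lsingle fun _ => y, fun g => ?_⟩, fun x => ?_⟩
    · ext1
      have : powAct a 1 (g : G) (fun _ => y) = fun _ => y := funext fun _ => hy g g.2
      refine Eq.symm ((permRep_single (R := R) (powAct a 1) (g : G) (fun _ => y) 1).trans ?_)
      rw [this]
      rfl
    · simp [augmentation]
  fSplit_d i H hH := by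
    obtain ⟨y, hy⟩ := ha.exists_fixed H hH
    refine ⟨⟨cone R (i + 1) y, fun g => LinearMap.ext fun c => ?_⟩, fun c => ?_⟩
    · have := cone_permRep (R := R) a (g : G) y c
      rw [hy g g.2] at this
      exact this
    · have := bd_cone y (bd R Y (i + 1) c)
      rw [bd_bd, map_zero, sub_zero] at this
      exact this

/-- The retraction `r` makes the boundaries in degree `n` (tuples of `n + 1` points) a direct
summand with complementary projection `1 - r`, so the standard resolution can be truncated there. -/
theorem Acyclic.hasFResolution {n : ℕ} (h : Acyclic R a n) (ha : IsProperUniversal a) :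
    HasFResolution R G n := by
  obtain ⟨r, hr, hr1, hr2⟩ := h.exists_retraction (Nat.lt_succ_self n)
  let e : ((Fin (n + 1) → Y) →₀ R) →ₗ[R] ((Fin (n + 1) → Y) →₀ R) :=
    LinearMap.id - Finsupp.linearCombination R r
  have he : ∀ g c, e (permRep (powAct a (n + 1)) g c) = permRep (powAct a (n + 1)) g (e c) := by
    intro g c
    simp only [e, LinearMap.sub_apply, LinearMap.id_apply, map_sub]
    rw [linearCombination_permRep hr]
  have he1 : ∀ c, e (bd R Y (n + 1) c) = 0 := fun c => sub_eq_zero.2 (hr2 c).symm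
  have he2 : ∀ c, e c - c ∈ LinearMap.range (bd R Y (n + 1)) := by
    intro c
    simp only [e, LinearMap.sub_apply, LinearMap.id_apply, sub_sub_cancel_left]
    refine Submodule.neg_mem _ ?_
    rw [Finsupp.linearCombination_apply]
    exact Submodule.sum_mem _ fun y _ => Submodule.smul_mem _ _ (hr1 y)
  exact (standardResolution ha).exists_lengthLE n ⟨e, fun g => LinearMap.ext (he g)⟩ he1 he2

/-- The `G`-set `Δ` as a permutation action. -/
abbrev deltaPerm (G : Type v) [Group G] : G →* Equiv.Perm (Delta G) :=
  MulAction.toPermHom G (Delta G)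

lemma isProperUniversal_delta (G : Type v) [Group G] : IsProperUniversal (deltaPerm G) where
  finite_stab y := finite_stabilizer_delta y
  exists_fixed H hH := by
    refine ⟨⟨⟨H, hH⟩, (1 : G)⟩, fun h hh => ?_⟩
    have : h • ((1 : G) : G ⧸ H) = ((1 : G) : G ⧸ H) :=
      QuotientGroup.eq.2 (by simpa using H.inv_mem hh)
    exact congrArg (Sigma.mk (β := fun H : {H : Subgroup G // Finite H} => G ⧸ H.1) ⟨H, hH⟩) this

/-- Instead of restricting modules, pass to acyclicity of the `K`-set `Δ` and back. -/
lemma HasFResolution.of_injective {K : Type v} [Group K] {j : K →* G} (hj : Function.Injective j)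
    {n : ℕ} (h : HasFResolution R G n) : HasFResolution R K n :=
  (h.acyclic hj (isProperUniversal_delta K)).hasFResolution (isProperUniversal_delta K)

end Standard

/-! ### Equivariant contractions and their conjugates -/

section Homotopy

variable {R : Type u} [CommRing R] {G : Type*} [Group G] {X : Type v} {x : G →* Equiv.Perm X}

/-- Above its dimension an acyclic standard complex has an equivariant contraction. -/
lemma Acyclic.exists_homotopy {n m : ℕ} (h : Acyclic R x n) (hm : n < m) :
    ∃ (s : ((Fin m → X) →₀ R) →ₗ[R] ((Fin (m + 1) → X) →₀ R))
      (t : ((Fin (m + 1) → X) →₀ R) →ₗ[R] ((Fin (m + 2) → X) →₀ R)),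
      (∀ g c, s (permRep (powAct x m) g c) = permRep (powAct x (m + 1)) g (s c)) ∧
      (∀ g c, t (permRep (powAct x (m + 1)) g c) = permRep (powAct x (m + 2)) g (t c)) ∧
      ∀ c, bd R X (m + 1) (t c) + s (bd R X m c) = c := by
  obtain ⟨r, hr, hr1, hr2⟩ := h.exists_retraction hm
  obtain ⟨m, rfl⟩ : ∃ k, m = k + 1 := ⟨m - 1, by omega⟩
  -- Taking the first vertex of `y` as apex keeps the cone equivariant without a fixed point.
  let s : ((Fin (m + 1) → X) →₀ R) →ₗ[R] ((Fin (m + 2) → X) →₀ R) :=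
    Finsupp.linearCombination R fun y => cone R (m + 1) (y 0) (r y)
  have hs : ∀ g c, s (permRep (powAct x (m + 1)) g c) = permRep (powAct x (m + 2)) g (s c) :=
    fun g c => linearCombination_permRep (fun g y => by
      rw [hr g y, powAct_apply, cone_permRep]) g c
  have hbs : ∀ c, bd R X (m + 1) (s c) = Finsupp.linearCombination R r c := fun c => by
    have : bd R X (m + 1) ∘ₗ s = Finsupp.linearCombination R r := by
      ext1 y
      ext1
      obtain ⟨c', hc'⟩ := hr1 y
      simp only [LinearMap.comp_apply, Finsupp.lsingle_apply, s,
        Finsupp.linearCombination_single, one_smul]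
      rw [bd_cone, ← hc', bd_bd, map_zero, sub_zero]
    exact congrArg (fun φ => φ c) this
  -- The chain being coned is a cycle, because `bd ∘ s = r` is the identity on boundaries.
  let t : ((Fin (m + 2) → X) →₀ R) →ₗ[R] ((Fin (m + 3) → X) →₀ R) :=
    Finsupp.linearCombination R fun y =>
      cone R (m + 2) (y 0) (Finsupp.single y 1 - s (bd R X (m + 1) (Finsupp.single y 1)))
  refine ⟨s, t, hs, fun g c => linearCombination_permRep (fun g y => ?_) g c, fun c => ?_⟩
  · rw [← permRep_single, bd_permRep, hs, ← map_sub, powAct_apply, cone_permRep]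
  · have : bd R X (m + 2) ∘ₗ t + s ∘ₗ bd R X (m + 1) = LinearMap.id := by
      ext1 y
      ext1
      simp only [LinearMap.comp_apply, LinearMap.add_apply, Finsupp.lsingle_apply, t,
        Finsupp.linearCombination_single, one_smul, LinearMap.id_apply]
      rw [bd_cone, map_sub, hbs, hr2, sub_self, map_zero, sub_zero, sub_add_cancel]
    exact congrArg (fun φ => φ c) this

end Homotopy

section Conjugation

variable {R : Type u} [CommRing R] {G : Type v} [Group G] (N : Subgroup G) {V W : Type*}
  [AddCommGroup V] [Module R V] [AddCommGroup W] [Module R W] {σ : Representation R G V}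
  {τ : Representation R G W}

/-- The conjugates of an `N`-linear map, indexed by the cosets of `N`. -/
lemma exists_conj (s : V →ₗ[R] W) (hs : ∀ g ∈ N, ∀ v, s (σ g v) = τ g (s v)) :
    ∃ k : G ⧸ N → V →ₗ[R] W, ∀ (g : G) v, k (g : G ⧸ N) v = τ g (s (σ g⁻¹ v)) := by
  refine ⟨fun c => Quotient.liftOn' c (fun g => τ g ∘ₗ s ∘ₗ σ g⁻¹) fun g h hgh => ?_,
    fun g v => rfl⟩
  ext v
  have h1 : g⁻¹ * h ∈ N := QuotientGroup.leftRel_apply.1 hgh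
  have h2 := hs _ h1 (σ h⁻¹ v)
  have h3 : σ (g⁻¹ * h) (σ h⁻¹ v) = σ g⁻¹ v := by
    rw [← Module.End.mul_apply, ← map_mul]; simp
  rw [h3] at h2
  simp only [LinearMap.comp_apply]
  rw [h2, ← Module.End.mul_apply, ← map_mul, mul_inv_cancel_left]

lemma conj_equivariant {s : V →ₗ[R] W} {k : G ⧸ N → V →ₗ[R] W}
    (hk : ∀ (g : G) v, k (g : G ⧸ N) v = τ g (s (σ g⁻¹ v))) (g : G) (c : G ⧸ N) (v : V) :
    k (g • c) (σ g v) = τ g (k c v) := by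
  obtain ⟨h, rfl⟩ := QuotientGroup.mk_surjective c
  rw [hk, MulAction.Quotient.smul_coe, smul_eq_mul, hk, map_mul, Module.End.mul_apply]
  congr 3
  rw [← Module.End.mul_apply, ← map_mul]
  simp

end Conjugation

/-! ### Functions on cosets, subsets of cosets, multilinear extension -/

section Coinduced

variable {G : Type v} [Group G] (N : Subgroup G) {X : Type v} (x : G →* Equiv.Perm X)

/-- The `G`-set of functions on the cosets of `N`, with the conjugation action. -/
def coindPerm : G →* Equiv.Perm (G ⧸ N → X) where
  toFun g :=
    { toFun := fun φ c => x g (φ (g⁻¹ • c))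
      invFun := fun φ c => x g⁻¹ (φ (g • c))
      left_inv := fun φ => by ext c; simp
      right_inv := fun φ => by ext c; simp }
  map_one' := by ext; simp
  map_mul' g h := by ext; simp [mul_smul]

lemma coindPerm_apply (g : G) (φ : G ⧸ N → X) (c : G ⧸ N) :
    coindPerm N x g φ c = x g (φ (g⁻¹ • c)) := rfl

-- Constant functions supply fixed points. A stabiliser element of `φ` lying in `N` stabilises `φ
-- 1`, and `N` has finite index.
variable {x} in
lemma IsProperUniversal.coind [N.FiniteIndex] (h : IsProperUniversal x) :
    IsProperUniversal (coindPerm N x) where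
  finite_stab φ := by
    refine Set.Finite.of_finite_fibers (fun g : G => (g : G ⧸ N)) (Set.toFinite _) ?_
    rintro _ ⟨g, hg, rfl⟩
    refine Set.Finite.subset ((h.finite_stab (φ (1 : G))).image fun k => g * k) ?_
    rintro k ⟨hk, hkg⟩
    refine ⟨g⁻¹ * k, ?_, by simp⟩
    have h1 : coindPerm N x (g⁻¹ * k) φ = φ := by
      rw [map_mul, Equiv.Perm.mul_apply, show coindPerm N x k φ = φ from hk, map_inv,
        Equiv.Perm.inv_eq_iff_eq, show coindPerm N x g φ = φ from hg]
    have h2 := congrFun h1 (1 : G)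
    rw [coindPerm_apply] at h2
    have h3 : (g⁻¹ * k)⁻¹ • ((1 : G) : G ⧸ N) = ((1 : G) : G ⧸ N) := by
      refine QuotientGroup.eq.2 ?_
      have : ((k : G) : G ⧸ N) = (g : G ⧸ N) := hkg
      simpa using QuotientGroup.eq.1 this.symm
    rwa [h3] at h2
  exists_fixed H hH := by
    obtain ⟨y, hy⟩ := h.exists_fixed H hH
    exact ⟨fun _ => y, fun h hh => funext fun _ => hy h hh⟩

end Coinduced

section Subsets

open scoped Pointwise

variable {G : Type v} [Group G] (N : Subgroup G) [DecidableEq (G ⧸ N)]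

lemma le_stabilizer_subset [N.Normal] (s : Finset (G ⧸ N)) : N ≤ MulAction.stabilizer G s := by
  have htriv : ∀ n ∈ N, ∀ c : G ⧸ N, n • c = c := by
    intro n hn c
    obtain ⟨g, rfl⟩ := QuotientGroup.mk_surjective c
    refine QuotientGroup.eq.2 ?_
    have := ‹N.Normal›.conj_mem _ (N.inv_mem hn) g⁻¹
    simpa [mul_assoc] using this
  intro n hn
  rw [MulAction.mem_stabilizer_iff]
  ext c
  rw [← Finset.inv_smul_mem_iff, htriv _ (N.inv_mem hn)]

variable [Fintype (G ⧸ N)]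

/-- The proper nonempty subsets of `G ⧸ N`. -/
abbrev ProperSubset : Type v := {s : Finset (G ⧸ N) // s ≠ ∅ ∧ s ≠ Finset.univ}

/-- The action on proper nonempty subsets. -/
def subsetPerm : G →* Equiv.Perm (ProperSubset N) where
  toFun g :=
    { toFun := fun s => ⟨g • s.1, by simp [s.2.1], by
        rw [Ne, Finset.smul_finset_eq_univ]; exact s.2.2⟩
      invFun := fun s => ⟨g⁻¹ • s.1, by simp [s.2.1], by
        rw [Ne, Finset.smul_finset_eq_univ]; exact s.2.2⟩
      left_inv := fun s => by ext; simp
      right_inv := fun s => by ext; simp }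
  map_one' := by ext; simp
  map_mul' g h := by ext; simp [mul_smul]

lemma subsetPerm_coe (g : G) (s : ProperSubset N) : (subsetPerm N g s).1 = g • s.1 := rfl

/-- By transitivity on `G ⧸ N`. Hence all transfers come from proper subgroups, where induction on
the index applies. -/
lemma stabilizer_subset_ne_top (s : ProperSubset N) : MulAction.stabilizer G s.1 ≠ ⊤ := by
  intro h
  obtain ⟨c, hc⟩ := Finset.nonempty_iff_ne_empty.2 s.2.1
  refine s.2.2 (Finset.eq_univ_iff_forall.2 fun c' => ?_)
  obtain ⟨g, rfl⟩ := MulAction.exists_smul_eq G c c'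
  have : g ∈ MulAction.stabilizer G s.1 := by rw [h]; trivial
  rw [← MulAction.mem_stabilizer_iff.1 this]
  exact Finset.smul_mem_smul_finset hc

lemma sum_finset_eq {A : Type*} [AddCommGroup A] (F : Finset (G ⧸ N) → A) :
    ∑ s, F s = F Finset.univ + F ∅ + ∑ s : ProperSubset N, F s := by
  have h0 : (∅ : Finset (G ⧸ N)) ≠ Finset.univ := Finset.univ_nonempty.ne_empty.symm
  rw [← Finset.add_sum_erase _ _ (Finset.mem_univ Finset.univ),
    ← Finset.add_sum_erase _ _ (Finset.mem_erase.2 ⟨h0, Finset.mem_univ _⟩), add_assoc]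
  congr 2
  refine Finset.sum_subtype _ (fun s => ?_) F
  simp

end Subsets

section MultiExt

variable {R : Type*} [CommRing R] {C I A : Type*} [Fintype C] [AddCommGroup A] [Module R A]

/-- The multilinear extension of a function on tuples of basis elements. -/
noncomputable def multiExt (w : (C → I) → A) : MultilinearMap R (fun _ : C => I →₀ R) A := by
  classical
  exact (Finsupp.linearCombination R w ∘ₗ
    (PiTensorProduct.ofFinsuppEquiv' (κ := fun _ : C => I)).toLinearMap).compMultilinearMap
      (PiTensorProduct.tprod R)

lemma multiExt_single (w : (C → I) → A) (i : C → I) :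
    multiExt (R := R) w (fun c => Finsupp.single (i c) 1) = w i := by
  simp [multiExt]

lemma multilinear_finsupp_ext {F F' : MultilinearMap R (fun _ : C => I →₀ R) A}
    (h : ∀ i : C → I, F (fun c => Finsupp.single (i c) 1) = F' fun c => Finsupp.single (i c) 1) :
    F = F' :=
  Module.Basis.ext_multilinear (fun _ => Finsupp.basisSingleOne) fun i => by simpa using h i

end MultiExt

/-! ### Multilinear maps modulo transfers -/

section Traces

open scoped Pointwise

variable {R : Type u} [CommRing R] {G : Type v} [Group G] (N : Subgroup G)
  {P A Z : Type*} [AddCommGroup P] [Module R P] [AddCommGroup A] [Module R A]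

/-- The action of `G` on the tensor induced module, on families indexed by cosets. -/
def cosetAct (p : Representation R G P) (g : G) (v : G ⧸ N → P) : G ⧸ N → P :=
  fun c => p g (v (g⁻¹ • c))

/-- Equivariant maps to families indexed by cosets. -/
def eqFamilies (z : G →* Equiv.Perm Z) (p : Representation R G P) :
    AddSubgroup (Z → G ⧸ N → P) where
  carrier := {u | ∀ g x, u (z g x) = cosetAct N p g (u x)}
  zero_mem' g x := by ext; simp [cosetAct]
  add_mem' {u v} hu hv g x := by
    ext c
    simp only [Pi.add_apply, hu g x, hv g x, cosetAct, map_add]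
  neg_mem' {u} hu g x := by
    ext c
    simp only [Pi.neg_apply, hu g x, cosetAct, map_neg]

variable [DecidableEq (G ⧸ N)] [Fintype (G ⧸ N)]

/-- Sums of equivariant families indexed by the proper nonempty subsets of `G ⧸ N`: these are
sums of transfers from proper subgroups. -/
def traces (z : G →* Equiv.Perm Z) (ρ : Representation R G A) : AddSubgroup (Z → A) where
  carrier := {θ | ∃ w : ProperSubset N → Z → A,
    (∀ g s x, w (subsetPerm N g s) (z g x) = ρ g (w s x)) ∧ θ = ∑ s, w s}
  zero_mem' := ⟨0, by simp, by simp⟩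
  add_mem' := by
    rintro _ _ ⟨w, hw, rfl⟩ ⟨w', hw', rfl⟩
    exact ⟨w + w', fun g s x => by simp [hw, hw'], by simp [Finset.sum_add_distrib]⟩
  neg_mem' := by
    rintro _ ⟨w, hw, rfl⟩
    exact ⟨-w, fun g s x => by simp [hw], by simp⟩

variable {z : G →* Equiv.Perm Z} {p : Representation R G P} {ρ : Representation R G A}

/-- Expand `Φ (u + v)` over the sets of factors in which `u` is used: the full and empty sets give
`Φ u` and `Φ v`, and `G` permutes the remaining terms. -/
lemma multilinear_add_sub_mem_traces {Φ : MultilinearMap R (fun _ : G ⧸ N => P) A}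
    (hΦ : ∀ g v, Φ (cosetAct N p g v) = ρ g (Φ v)) {u v : Z → G ⧸ N → P}
    (hu : u ∈ eqFamilies N z p) (hv : v ∈ eqFamilies N z p) :
    (fun x => Φ (u x + v x)) - ((fun x => Φ (u x)) + fun x => Φ (v x)) ∈ traces N z ρ := by
  refine ⟨fun s x => Φ (s.1.piecewise (u x) (v x)), fun g s x => ?_, ?_⟩
  · rw [← hΦ]
    refine congrArg Φ (funext fun c => ?_)
    rw [subsetPerm_coe, cosetAct]
    by_cases hc : c ∈ g • s.1
    · rw [Finset.piecewise_eq_of_mem _ _ _ hc,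
        Finset.piecewise_eq_of_mem _ _ _ (Finset.inv_smul_mem_iff.2 hc), hu g x, cosetAct]
    · rw [Finset.piecewise_eq_of_notMem _ _ _ hc,
        Finset.piecewise_eq_of_notMem _ _ _ (mt Finset.inv_smul_mem_iff.1 hc), hv g x, cosetAct]
  · ext x
    simp only [Pi.sub_apply, Pi.add_apply, Finset.sum_apply]
    rw [Φ.map_add_univ, sum_finset_eq]
    simp

/-- Modulo transfers, an equivariant multilinear map is additive. -/
def multilinearModTraces (z : G →* Equiv.Perm Z) (Φ : MultilinearMap R (fun _ : G ⧸ N => P) A)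
    (hΦ : ∀ g v, Φ (cosetAct N p g v) = ρ g (Φ v)) :
    eqFamilies N z p →+ (Z → A) ⧸ traces N z ρ :=
  AddMonoidHom.mk' (fun u => QuotientAddGroup.mk fun x => Φ (u.1 x)) fun u v => by
    refine (QuotientAddGroup.eq_iff_sub_mem).2 ?_
    exact multilinear_add_sub_mem_traces N hΦ u.2 v.2

lemma multilinearModTraces_apply (Φ : MultilinearMap R (fun _ : G ⧸ N => P) A)
    (hΦ : ∀ g v, Φ (cosetAct N p g v) = ρ g (Φ v)) (u : eqFamilies N z p) :
    multilinearModTraces N z Φ hΦ u = QuotientAddGroup.mk fun x => Φ (u.1 x) := rfl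

end Traces

section Slices

variable {R : Type u} [CommRing R] {G : Type v} [Group G] (N : Subgroup G) {X : Type v}
  (x : G →* Equiv.Perm X) {A : Type*} [AddCommGroup A] [Module R A] {k : ℕ}

variable (R) in
/-- The pure tensor of basis elements given by a tuple of functions on `G ⧸ N`. -/
noncomputable def slices (y : Fin k → G ⧸ N → X) : G ⧸ N → ((Fin k → X) →₀ R) :=
  fun c => Finsupp.single (fun i => y i c) 1

lemma slices_act (g : G) (y : Fin k → G ⧸ N → X) :
    slices R N (powAct (coindPerm N x) k g y)
      = cosetAct N (permRep (powAct x k)) g (slices R N y) := by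
  ext1 c
  simp only [slices, cosetAct, permRep_single]
  rfl

lemma bd_slices (y : Fin (k + 1) → G ⧸ N → X) (c : G ⧸ N) :
    bd R X k (slices R N y c)
      = ∑ j : Fin (k + 1), (-1 : ℤ) ^ (j : ℕ) • slices R N (j.removeNth y) c := by
  rw [slices, bd_single, cobd_apply]
  rfl

variable [Fintype (G ⧸ N)]

/-- The multilinear extension of a cochain on functions on `G ⧸ N`. -/
noncomputable def multi (f : (Fin k → G ⧸ N → X) → A) :
    MultilinearMap R (fun _ : G ⧸ N => (Fin k → X) →₀ R) A :=
  multiExt fun α => f fun i c => α c i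

lemma multi_slices (f : (Fin k → G ⧸ N → X) → A) (y : Fin k → G ⧸ N → X) :
    multi (R := R) N f (slices R N y) = f y :=
  multiExt_single _ _

lemma multi_ext {F F' : MultilinearMap R (fun _ : G ⧸ N => (Fin k → X) →₀ R) A}
    (h : ∀ y, F (slices R N y) = F' (slices R N y)) : F = F' :=
  multilinear_finsupp_ext fun i => h fun j c => i c j

-- Pure tensors of basis elements suffice. Two cochains are allowed so that the result applies to
-- families permuted by `G`.
variable {x} in
lemma multi_act {ρ : Representation R G A} {g : G} {f f' : (Fin k → G ⧸ N → X) → A}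
    (h : ∀ y, f' (powAct (coindPerm N x) k g y) = ρ g (f y))
    (v : G ⧸ N → ((Fin k → X) →₀ R)) :
    multi N f' (cosetAct N (permRep (powAct x k)) g v) = ρ g (multi N f v) := by
  have : (((multi (R := R) N f').compLinearMap fun _ => permRep (powAct x k) g).domDomCongr
      (MulAction.toPerm g⁻¹)) = (ρ g).compMultilinearMap (multi N f) := by
    refine multi_ext N fun y => ?_
    have h1 : multi (R := R) N f' (cosetAct N (permRep (powAct x k)) g (slices R N y))
        = ρ g (multi N f (slices R N y)) := by
      rw [← slices_act, multi_slices, multi_slices, h]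
    exact h1
  exact congrArg (fun F => F v) this

end Slices

/-! ### Finite extensions -/

section FiniteIndex

open scoped Pointwise

variable {R : Type u} [CommRing R] {G : Type v} [Group G] (N : Subgroup G)
  [DecidableEq (G ⧸ N)] [Fintype (G ⧸ N)]

/-- A cocycle in the top degree that is a sum of transfers is a coboundary, if there is no
cohomology in this degree over the proper subgroups containing `N`. -/
lemma exists_cobd_eq_of_mem_traces [N.Normal] {Y : Type v} {a : G →* Equiv.Perm Y}
    (ha : IsProperUniversal a) {n m : ℕ} (hm : n < m)
    (hL : ∀ L : Subgroup G, N ≤ L → L ≠ ⊤ → HasFResolution R L n) (htop : Acyclic R a m)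
    {A : Type max u v} [AddCommGroup A] [Module R A] {ρ : Representation R G A}
    {θ : (Fin (m + 1) → Y) → A} (hθ : θ ∈ traces N (powAct a (m + 1)) ρ) (hd : cobd θ = 0) :
    ∃ k : (Fin m → Y) → A, IsEquivariant (powAct a m) ρ k ∧ cobd k = θ := by
  obtain ⟨w, hw, rfl⟩ := hθ
  obtain ⟨r, hr, hr1, hr2⟩ := htop.exists_retraction (Nat.lt_succ_self m)
  -- The summands `w s` need not be cocycles. Composing with `e`, which kills boundaries, makes them
  -- so, and leaves the sum unchanged because a cocycle vanishes on the boundaries `r y`.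
  let e : (Fin (m + 1) → Y) → ((Fin (m + 1) → Y) →₀ R) := fun y => Finsupp.single y 1 - r y
  have he : IsEquivariant (powAct a (m + 1)) (permRep (powAct a (m + 1))) e :=
    (isEquivariant_single _).sub hr
  have hde : cobd e = 0 := by
    ext1 y
    have h1 : cobd r y = cobd (fun y => Finsupp.single y (1 : R)) y := by
      rw [← bd_single, ← hr2, linearCombination_bd, Finsupp.linearCombination_single, one_smul]
    have h2 : e = (fun y => Finsupp.single y (1 : R)) - r := rfl
    rw [h2, map_sub, Pi.sub_apply, h1, sub_self]
    rfl
  let w' : ProperSubset N → (Fin (m + 1) → Y) → A := fun s y =>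
    Finsupp.linearCombination R (w s) (e y)
  have hw' : ∀ g s y, w' (subsetPerm N g s) (powAct a (m + 1) g y) = ρ g (w' s y) := by
    intro g s y
    have : Finsupp.linearCombination R (w (subsetPerm N g s)) ∘ₗ permRep (powAct a (m + 1)) g
        = ρ g ∘ₗ Finsupp.linearCombination R (w s) := by
      ext x
      simp [permRep_single, hw]
    simp only [w', he g y]
    exact congrArg (fun φ => φ (e y)) this
  have hdw' : ∀ s, cobd (w' s) = 0 := by
    intro s
    ext1 y
    refine (map_cobd (Finsupp.linearCombination R (w s)).toAddMonoidHom e y).symm.trans ?_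
    rw [hde]
    simp
  obtain ⟨k, hk, hk'⟩ := exists_cobd_eq_of_stabilizers (R := R) (a := a) (subsetPerm N) (n := n)
    (fun s => ⟨MulAction.stabilizer G s.1, fun g => by
      rw [MulAction.mem_stabilizer_iff, Subtype.ext_iff, subsetPerm_coe],
      (hL _ (le_stabilizer_subset N s.1) (stabilizer_subset_ne_top N s)).acyclic
        (π := MonoidHom.id _) Function.injective_id
        (ha.comp (Subgroup.subtype_injective _))⟩) ρ hm w' hw' hdw'
  refine ⟨∑ s, k s, fun g y => ?_, ?_⟩
  · simp only [Finset.sum_apply, map_sum]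
    rw [← Equiv.sum_comp (subsetPerm N g)]
    exact Finset.sum_congr rfl fun s _ => hk g s y
  · rw [map_sum]
    simp only [hk']
    ext y
    have h1 : ∀ c, ∑ s, Finsupp.linearCombination R (w s) c
        = Finsupp.linearCombination R (∑ s, w s) c := by
      intro c
      have : ∑ s, Finsupp.linearCombination R (w s) = Finsupp.linearCombination R (∑ s, w s) := by
        ext x
        simp
      rw [← this, LinearMap.sum_apply]
    obtain ⟨c, hc⟩ := hr1 y
    simp only [Finset.sum_apply, w', e]
    rw [h1, map_sub, ← hc, linearCombination_bd, hd]
    simp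

variable {X : Type v} {x : G →* Equiv.Perm X} {A : Type max u v} [AddCommGroup A] [Module R A]
  {ρ : Representation R G A}

/-- The differential of tensor induced chains is, modulo transfers, the differential of the
standard complex on functions on `G ⧸ N`. -/
lemma multilinear_bd_slices_mod_traces {k : ℕ} {P : Type*} [AddCommGroup P] [Module R P]
    {p : Representation R G P} (Φ : MultilinearMap R (fun _ : G ⧸ N => P) A)
    (hΦ : ∀ g v, Φ (cosetAct N p g v) = ρ g (Φ v))
    (s : G ⧸ N → ((Fin k → X) →₀ R) →ₗ[R] P)
    (hs : ∀ g c v, s (g • c) (permRep (powAct x k) g v) = p g (s c v)) :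
    (fun y => Φ fun c => s c (bd R X k (slices R N y c)))
      - cobd (fun y => Φ fun c => s c (slices R N y c))
      ∈ traces N (powAct (coindPerm N x) (k + 1)) ρ := by
  have hs' : ∀ g (v : G ⧸ N → ((Fin k → X) →₀ R)),
      (fun c => s c (cosetAct N (permRep (powAct x k)) g v c)) =
        cosetAct N p g fun c => s c (v c) := by
    intro g v
    ext1 c
    have := hs g (g⁻¹ • c) (v (g⁻¹ • c))
    rw [smul_inv_smul] at this
    exact this
  let z := powAct (coindPerm N x) (k + 1)
  let uj : Fin (k + 1) → eqFamilies N z p := fun j =>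
    ⟨fun y c => s c (slices R N (j.removeNth y) c), fun g y => by
      simp only [z, powAct_removeNth, slices_act, hs']⟩
  let Θ := multilinearModTraces (ρ := ρ) N z Φ hΦ
  have h1 : (fun y c => s c (bd R X k (slices R N y c)))
      = ((∑ j : Fin (k + 1), (-1 : ℤ) ^ (j : ℕ) • uj j : eqFamilies N z p) : _ → G ⧸ N → P) := by
    ext y c
    rw [bd_slices, AddSubgroup.val_finsetSum]
    simp [uj, map_sum, map_zsmul, Finset.sum_apply]
  have h2 : Θ (∑ j : Fin (k + 1), (-1 : ℤ) ^ (j : ℕ) • uj j)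
      = QuotientAddGroup.mk (cobd (fun y => Φ fun c => s c (slices R N y c))) := by
    rw [map_sum]
    have h3 : cobd (fun y => Φ fun c => s c (slices R N y c))
        = ∑ j : Fin (k + 1), (-1 : ℤ) ^ (j : ℕ) • fun y : Fin (k + 1) → G ⧸ N → X =>
          Φ fun c => s c (slices R N (j.removeNth y) c) := by
      ext y
      simp [cobd_apply]
    rw [h3, ← QuotientAddGroup.mk'_apply, map_sum]
    refine Finset.sum_congr rfl fun j _ => ?_
    -- Signs come out linearly modulo transfers, although multilinearity alone would give `(-1) ^ |G
    -- ⧸ N|` for each `-1`.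
    rw [map_zsmul, map_zsmul]
    rfl
  rw [multilinearModTraces_apply, ← h1] at h2
  exact QuotientAddGroup.eq_iff_sub_mem.1 h2

/-- The inductive step: if the cohomology of `G` vanishes above degree `m > n`, it also vanishes
in degree `m`. -/
lemma exists_cobd_eq_of_finiteIndex [N.Normal] (hx : IsProperUniversal x) {n m : ℕ} (hm : n < m)
    (hN : HasFResolution R N n)
    (hL : ∀ L : Subgroup G, N ≤ L → L ≠ ⊤ → HasFResolution R L n)
    (htop : Acyclic R (coindPerm N x) m) {f : (Fin (m + 1) → G ⧸ N → X) → A}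
    (hf : IsEquivariant (powAct (coindPerm N x) (m + 1)) ρ f) (hd : cobd f = 0) :
    ∃ k : (Fin m → G ⧸ N → X) → A, IsEquivariant (powAct (coindPerm N x) m) ρ k ∧
      cobd k = f := by
  have : N.FiniteIndex := Subgroup.finiteIndex_of_finite_quotient
  have hNx : Acyclic R (x.comp N.subtype) n :=
    hN.acyclic (π := MonoidHom.id N) Function.injective_id
      (hx.comp (Subgroup.subtype_injective N))
  -- The contraction is only `N`-equivariant; its conjugates, one for each tensor factor, form
  -- `G`-equivariant families.
  obtain ⟨s, t, hs, ht, hst⟩ := hNx.exists_homotopy hm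
  obtain ⟨sc, hsc⟩ := exists_conj N (σ := permRep (powAct x m)) (τ := permRep (powAct x (m + 1))) s
    fun g hg v => hs ⟨g, hg⟩ v
  obtain ⟨tc, htc⟩ := exists_conj N (σ := permRep (powAct x (m + 1)))
    (τ := permRep (powAct x (m + 2))) t fun g hg v => ht ⟨g, hg⟩ v
  have hsce := conj_equivariant N hsc
  have htce := conj_equivariant N htc
  have hstc : ∀ c v, bd R X (m + 1) (tc c v) + sc c (bd R X m v) = v := by
    intro c v
    obtain ⟨g, rfl⟩ := QuotientGroup.mk_surjective c
    rw [hsc, htc, bd_permRep x g, ← bd_permRep x g⁻¹, ← map_add, hst,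
      ← Module.End.mul_apply, ← map_mul]
    simp
  let Φ : MultilinearMap R (fun _ : G ⧸ N => (Fin (m + 1) → X) →₀ R) A := multi N f
  have hΦ : ∀ g v, Φ (cosetAct N (permRep (powAct x (m + 1))) g v) = ρ g (Φ v) :=
    fun g v => multi_act N (hf g) v
  let z := powAct (coindPerm N x) (m + 1)
  let k₁ : (Fin m → G ⧸ N → X) → A := fun y => Φ fun c => sc c (slices R N y c)
  have hk₁ : IsEquivariant (powAct (coindPerm N x) m) ρ k₁ := by
    intro g y
    simp only [k₁]
    rw [← hΦ, slices_act]
    refine congrArg Φ (funext fun c => ?_)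
    have := hsce g (g⁻¹ • c) (slices R N y (g⁻¹ • c))
    rw [smul_inv_smul] at this
    exact this
  have hsecond : (fun y => Φ fun c => sc c (bd R X m (slices R N y c))) - cobd k₁
      ∈ traces N z ρ := multilinear_bd_slices_mod_traces N Φ hΦ sc hsce
  have hfirst : (fun y => Φ fun c => bd R X (m + 1) (tc c (slices R N y c))) ∈ traces N z ρ := by
    have h1 := multilinear_bd_slices_mod_traces (k := m + 1) N Φ hΦ (fun _ => LinearMap.id)
      (x := x) (fun g c v => rfl)
    have h2 : (fun y => Φ fun c => (LinearMap.id : ((Fin (m + 1) → X) →₀ R) →ₗ[R] _)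
        (slices R N y c)) = f := by
      ext y
      exact multi_slices N f y
    rw [h2, hd, sub_zero] at h1
    obtain ⟨w, hw, hw'⟩ := h1
    -- The identity on pure tensors becomes one of multilinear maps, so that the chains `tc c
    -- (slices R N y c)` can be substituted.
    have h3 : Φ.compLinearMap (fun _ => bd R X (m + 1)) = ∑ s, multi N (w s) := by
      refine multi_ext N fun y => ?_
      have h4 := congrFun hw' y
      simp only [sum_apply, multi_slices]
      rw [Finset.sum_apply] at h4
      exact h4
    refine ⟨fun s y => multi N (w s) fun c => tc c (slices R N y c), fun g s y => ?_, ?_⟩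
    · rw [← multi_act N (hw g s)]
      simp only [z, slices_act]
      refine congrArg _ (funext fun c => ?_)
      have := htce g (g⁻¹ • c) (slices R N y (g⁻¹ • c))
      rw [smul_inv_smul] at this
      exact this
    · ext y
      have h4 := congrArg (fun F => F fun c => tc c (slices R N y c)) h3
      simp only [sum_apply] at h4
      rw [Finset.sum_apply]
      exact h4
  have hadd : f - ((fun y => Φ fun c => bd R X (m + 1) (tc c (slices R N y c)))
      + fun y => Φ fun c => sc c (bd R X m (slices R N y c))) ∈ traces N z ρ := by
    have h1 := multilinear_add_sub_mem_traces (z := z) N hΦ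
      (u := fun y c => bd R X (m + 1) (tc c (slices R N y c)))
      (v := fun y c => sc c (bd R X m (slices R N y c))) (fun g y => ?_) (fun g y => ?_)
    · have h2 : (fun y => Φ ((fun c => bd R X (m + 1) (tc c (slices R N y c)))
          + fun c => sc c (bd R X m (slices R N y c)))) = f := by
        ext y
        refine Eq.trans (congrArg Φ (funext fun c => ?_)) (multi_slices N f y)
        exact hstc c _
      rw [← h2]
      exact h1
    · ext1 c
      have := htce g (g⁻¹ • c) (slices R N y (g⁻¹ • c))
      rw [smul_inv_smul] at this
      simp only [z, slices_act]
      refine (congrArg (bd R X (m + 1)) this).trans ?_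
      exact bd_permRep x g _
    · ext1 c
      have := hsce g (g⁻¹ • c) (bd R X m (slices R N y (g⁻¹ • c)))
      rw [smul_inv_smul, ← bd_permRep] at this
      simp only [z, slices_act]
      exact this
  have hfin : f - cobd k₁ ∈ traces N z ρ := by
    have := add_mem (add_mem hadd hfirst) hsecond
    convert this using 1
    abel
  -- The difference `f - cobd k₁` is a cocycle and a sum of transfers, hence a coboundary.
  obtain ⟨k₂, hk₂, hk₂'⟩ := exists_cobd_eq_of_mem_traces N (hx.coind N) hm hL htop hfin (by
    rw [map_sub, hd, cobd_cobd, sub_zero])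
  exact ⟨k₁ + k₂, hk₁.add hk₂, by rw [map_add, hk₂', add_sub_cancel]⟩

end FiniteIndex

/-! ### Descending induction and the extension theorem -/

variable {R : Type u} [CommRing R]

lemma Acyclic.mono {G : Type*} [Group G] {Y : Type v} {a : G →* Equiv.Perm Y} {n m : ℕ}
    (h : Acyclic R a n) (hnm : n ≤ m) : Acyclic R a m :=
  fun A _ _ ρ b hb => h A ρ b (lt_of_le_of_lt hnm hb)

/-- Finite extensions do not raise the `𝔉`-cohomological dimension, as long as it stays finite. -/
theorem hasFResolution_of_finiteIndex {n M : ℕ} {G : Type v} [Group G] (N : Subgroup G)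
    [N.Normal] [N.FiniteIndex] (hN : HasFResolution R N n) (hG : HasFResolution R G M) :
    HasFResolution R G n := by
  induction hk : N.index using Nat.strong_induction_on generalizing G with
  | _ k ih =>
    classical
    have : Fintype (G ⧸ N) := Fintype.ofFinite _
    have hL : ∀ L : Subgroup G, N ≤ L → L ≠ ⊤ → HasFResolution R L n := by
      intro L hNL hLtop
      have hmul := Subgroup.relIndex_mul_index hNL
      have h0 : N.index ≠ 0 := Subgroup.FiniteIndex.index_ne_zero
      have hL1 : L.index ≠ 1 := fun h => hLtop (Subgroup.index_eq_one.1 h)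
      have hL0 : L.index ≠ 0 := fun h => h0 (by rw [← hmul, h, mul_zero])
      have hr0 : N.relIndex L ≠ 0 := fun h => h0 (by rw [← hmul, h, zero_mul])
      have : (N.subgroupOf L).FiniteIndex := ⟨hr0⟩
      refine ih (N.relIndex L) ?_ (N.subgroupOf L) ?_ ?_ rfl
      · rw [← hk, ← hmul]
        exact lt_mul_of_one_lt_right (Nat.pos_of_ne_zero hr0) (by omega)
      · exact hN.of_injective (j := (Subgroup.subgroupOfEquivOfLe hNL).toMonoidHom)
          (Subgroup.subgroupOfEquivOfLe hNL).injective
      · exact hG.of_injective (Subgroup.subtype_injective L)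
    have hx := isProperUniversal_delta G
    -- Vanishing is pushed down one degree at a time; the finite bound `M` provides the start.
    have hstep : ∀ j, Acyclic R (coindPerm N (deltaPerm G)) (n + j) →
        Acyclic R (coindPerm N (deltaPerm G)) n := by
      intro j
      induction j with
      | zero => exact id
      | succ j ihj =>
        intro htop
        refine ihj fun A _ _ ρ b hb f hf hd => ?_
        rcases Nat.lt_or_ge (n + (j + 1)) b with hb' | hb'
        · exact htop A ρ b hb' f hf hd
        · obtain rfl : b = n + (j + 1) := by omega
          exact exists_cobd_eq_of_finiteIndex N hx (by omega) hN hL htop hf hd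
    have hM : Acyclic R (coindPerm N (deltaPerm G)) M :=
      hG.acyclic (π := MonoidHom.id G) Function.injective_id (hx.coind N)
    exact (hstep M (hM.mono (Nat.le_add_left M n))).hasFResolution (hx.coind N)

lemma exists_of_Fcd_lt_top {G : Type v} [Group G] (h : Fcd R G < ⊤) :
    ∃ n : ℕ, Fcd R G = n ∧ HasFResolution R G n := by
  have hne : {m : ℕ∞ | ∃ n : ℕ, m = n ∧
      ∃ X : FResolution (Representation.trivial R G R), X.LengthLE n}.Nonempty := by
    by_contra hne
    rw [Set.not_nonempty_iff_eq_empty] at hne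
    rw [Fcd, hne, sInf_empty] at h
    exact lt_irrefl _ h
  obtain ⟨n, hn, hX⟩ := csInf_mem hne
  exact ⟨n, hn, hX⟩

lemma HasFResolution.Fcd_le {G : Type v} [Group G] {n : ℕ} (h : HasFResolution R G n) :
    Fcd R G ≤ n :=
  sInf_le ⟨n, rfl, h⟩

/-- Subadditivity under extensions, in terms of the length of resolutions. -/
theorem hasFResolution_extension {N G Q : Type v} [Group N] [Group G] [Group Q]
    (E : GroupExtension N G Q) {n q M : ℕ} (hN : HasFResolution R N n) (hQ : HasFResolution R Q q)
    (hG : HasFResolution R G M) : HasFResolution R G (n + q) := by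
  obtain ⟨X, hX⟩ := hQ
  have ha := isProperUniversal_delta G
  refine Acyclic.hasFResolution (acyclic_of_fResolution (π := E.rightHom) ha.finite_stab
    (fun F hF => ?_) X hX) ha
  let L := F.comap E.rightHom
  -- This is the copy of `N` inside `L`, of finite index because the image of `L` lies in `F`.
  let K : Subgroup L := (E.rightHom.comp L.subtype).ker
  have hKfin : K.FiniteIndex := by
    have : Finite (E.rightHom.comp L.subtype).range := by
      refine (Set.toFinite (F : Set Q)).subset ?_
      rintro _ ⟨g, rfl⟩
      exact g.2
    exact Subgroup.finiteIndex_ker _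
  have hK : HasFResolution R K n := by
    have hex : ∀ k : K, ∃ x : N, E.inl x = (k : L) := fun k => by
      have h1 : ((k : L) : G) ∈ E.rightHom.ker := k.2
      rw [← E.range_inl_eq_ker_rightHom] at h1
      exact h1
    choose j hj using hex
    have hinj := E.inl_injective
    refine hN.of_injective (j := ⟨⟨j, hinj ?_⟩, fun x y => hinj ?_⟩) fun x y hxy => ?_
    · rw [hj]; simp
    · simp [hj]
    · have h1 : j x = j y := hxy
      exact Subtype.ext (Subtype.ext (by rw [← hj, ← hj, h1]))
  have hL : HasFResolution R L n :=
    hasFResolution_of_finiteIndex K hK (hG.of_injective (Subgroup.subtype_injective L))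
  exact hL.acyclic (π := MonoidHom.id L) Function.injective_id
    (ha.comp (Subgroup.subtype_injective L))

end FCohomology

theorem mainTheorem5 {R : Type u} [CommRing R] {N G Q : Type v} [Group N] [Group G] [Group Q]
    (E : GroupExtension N G Q) (hG : FCohomology.Fcd R G < ⊤) :
    FCohomology.Fcd R G ≤ FCohomology.Fcd R N + FCohomology.Fcd R Q := by
  obtain ⟨M, -, hM⟩ := FCohomology.exists_of_Fcd_lt_top hG
  rcases eq_or_ne (FCohomology.Fcd R N) ⊤ with hN | hN
  · rw [hN, top_add]
    exact le_top
  rcases eq_or_ne (FCohomology.Fcd R Q) ⊤ with hQ | hQ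
  · rw [hQ, add_top]
    exact le_top
  obtain ⟨n, hn, hn'⟩ := FCohomology.exists_of_Fcd_lt_top (lt_top_iff_ne_top.2 hN)
  obtain ⟨q, hq, hq'⟩ := FCohomology.exists_of_Fcd_lt_top (lt_top_iff_ne_top.2 hQ)
  rw [hn, hq]
  exact_mod_cast (FCohomology.hasFResolution_extension E hn' hq' hM).Fcd_le
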